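/- **Lemma (Gauss equation in the Kim–McCann geometry).** Let $X,Y\subset\mathbb R^d$ be open, let $c\colon X\times Y\to\mathbb R$, $\phi\colon X\to\mathbb R$, $\psi\colon Y\to\mathbb R$ be functions, put $u(x,y)=c(x,y)-\phi(x)-\psi(y)$, and suppose that $u\ge 0$ on $X\times Y$ and that $\Sigma=\{(x,y)\in X\times Y: u(x,y)=0\}$ is the graph of a $C^3$ map $X\to Y$, $x\mapsto y(x)$. Suppose that $c$ is $C^4$ near every point of $\Sigma$, that $\phi$ is $C^2$ on $X$ and that $\psi$ is $C^2$ near every point of $y(X)$. *Notation.* Repeated indices are summed. Unbarred indices $i,j,\dots$ refer to the coordinates $x^i$ and barred indices $\bar\imath,\bar\jmath,\dots$ to the coordinates $y^{\bar\imath}$; subscripts on $c$ and $u$ are partial derivatives; $u^{ij}$ and $u^{\bar\imath\bar\jmath}$ are the inverse matrices of $u_{ij}$ and $u_{\bar\imath\bar\jmath}$, and all quantities are evaluated on $\Sigma$, at $(x,y(x))$. Near $\Sigma$ let $\tilde g=\langle\cdot,\cdot\rangle$ be the Kim–McCann metric $$\tilde g=-\tfrac12\begin{pmatrix}0&D^2_{xy}c\\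 (D^2_{xy}c)^{T}&0\end{pmatrix},$$ let $\tilde\nabla$ be its Levi-Civita connection, $\tilde R(U,V)W=\tilde\nabla_V\tilde\nabla_UW-\tilde\nabla_U\tilde\nabla_VW-\tilde\nabla_{[V,U]}W$ its curvature tensor, $\tilde R_{\alpha\beta\gamma\delta}=\langle\tilde R(e_\alpha,e_\beta)e_\gamma,e_\delta\rangle$ its components in the coordinate frame $e_i=\partial_i$, $e_{\bar\imath}=\partial_{\bar\imath}$, and $\tilde R=\tilde g^{\alpha\gamma}\tilde g^{\beta\delta}\tilde R_{\alpha\beta\gamma\delta}$ its scalar curvature. Let $K(\xi,\eta)=(\xi,-\eta)$ and let $t_i=e_i+\partial_iy^{\bar\imath}\,e_{\bar\imath}$ be the coordinate tangent vectors of $\Sigma$. Let $g_{ij}(x)=\tilde g(t_i,t_j)$ be the metric induced on $\Sigma$, in the coordinates $x$, and **assume that $g$ is definite**. Let $R_{ijk\ell}$ and $R=g^{ik}g^{j\ell}R_{ijk\ell}$ be the curvature components and the scalar curvature of the Levi-Civita connection of $g$, with the same conventions as for $\tilde g$. Let $h(U,V)$, the second fundamental form, be the component of $\tilde\nabla_UV$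 that is $\tilde g$-orthogonal to $\Sigma$ ($U,V$ tangent to $\Sigma$), and set $h_{ijk}=\langle Kh(t_i,t_j),t_k\rangle$, $H=g^{ij}h(t_i,t_j)$ and $\langle h,h\rangle=g^{ik}g^{j\ell}\langle h(t_i,t_j),h(t_k,t_\ell)\rangle$. *Claim.* At every point of $\Sigma$ and for all indices $i,j,k,\ell$, $$\tilde R_{i\bar\jmath\bar k\ell}\,\partial_jy^{\bar\jmath}\partial_ky^{\bar k}+\tilde R_{i\bar\jmath k\bar\ell}\,\partial_jy^{\bar\jmath}\partial_\ell y^{\bar\ell}+\tilde R_{\bar\imath j\bar k\ell}\,\partial_iy^{\bar\imath}\partial_ky^{\bar k}+\tilde R_{\bar\imath jk\bar\ell}\,\partial_iy^{\bar\imath}\partial_\ell y^{\bar\ell}=R_{ijk\ell}+h_{iks}h_{j\ell t}u^{st}-h_{i\ell s}h_{jkt}u^{st},$$ and $$\tilde R_{i\bar\jmath k\bar\ell}\,u^{ik}u^{\bar\jmath\bar\ell}=-\tfrac18\tilde R+\tfrac12R-\tfrac12\langle H,H\rangle+\tfrac12\langle h,h\rangle .$$ -/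

import Mathlib

namespace KimMcCann

section PseudoRiemannian

/-! Pseudo-Riemannian geometry in one coordinate chart: the points are `ι → ℝ`, a metric is a
matrix-valued function, a vector field is a vector-valued function. -/

variable {ι : Type} [Fintype ι] [DecidableEq ι]

/-- The partial derivative `∂ₐ f` at `p`. -/
noncomputable def pd (a : ι) (f : (ι → ℝ) → ℝ) (p : ι → ℝ) : ℝ :=
  fderiv ℝ f p (Pi.single a 1)

/-- The bilinear form `⟨v, w⟩` with matrix `G`. -/
def pairing (G : Matrix ι ι ℝ) (v w : ι → ℝ) : ℝ :=
  ∑ a, ∑ b, G a b * v a * w b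

/-- Christoffel symbols `Γᵏᵢⱼ` of the Levi-Civita connection of the metric `g`. -/
noncomputable def christoffel (g : (ι → ℝ) → Matrix ι ι ℝ) (k i j : ι) (p : ι → ℝ) : ℝ :=
  1 / 2 * ∑ l, (g p)⁻¹ k l *
    (pd i (fun q => g q j l) p + pd j (fun q => g q i l) p - pd l (fun q => g q i j) p)

/-- The Levi-Civita covariant derivative `∇_U V` of the metric `g`. -/
noncomputable def covDeriv (g : (ι → ℝ) → Matrix ι ι ℝ) (U V : (ι → ℝ) → ι → ℝ)
    (p : ι → ℝ) : ι → ℝ := fun k =>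
  ∑ i, U p i * pd i (fun q => V q k) p + ∑ i, ∑ j, christoffel g k i j p * U p i * V p j

/-- The curvature tensor `R(U,V)W = ∇_V ∇_U W - ∇_U ∇_V W - ∇_[V,U] W`. -/
noncomputable def curvature (g : (ι → ℝ) → Matrix ι ι ℝ) (U V W : (ι → ℝ) → ι → ℝ)
    (p : ι → ℝ) : ι → ℝ :=
  covDeriv g V (covDeriv g U W) p - covDeriv g U (covDeriv g V W) p
    - covDeriv g (VectorField.lieBracket ℝ V U) W p

/-- The coordinate vector field `eₐ`. -/
def coordField (a : ι) : (ι → ℝ) → ι → ℝ := fun _ => Pi.single a 1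

/-- The components `R_{abce} = ⟨R(eₐ, e_b) e_c, e_e⟩` of the curvature tensor. -/
noncomputable def riem (g : (ι → ℝ) → Matrix ι ι ℝ) (a b c e : ι) (p : ι → ℝ) : ℝ :=
  pairing (g p) (curvature g (coordField a) (coordField b) (coordField c) p) (coordField e p)

/-- The scalar curvature `g^{ac} g^{be} R_{abce}` (positive on round spheres). -/
noncomputable def scalarCurv (g : (ι → ℝ) → Matrix ι ι ℝ) (p : ι → ℝ) : ℝ :=
  ∑ a, ∑ b, ∑ c, ∑ e, (g p)⁻¹ a c * (g p)⁻¹ b e * riem g a b c e p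

/-- The matrix of second partial derivatives `∂ᵢ∂ⱼ f` at `p`. -/
noncomputable def hess (f : (ι → ℝ) → ℝ) (p : ι → ℝ) : Matrix ι ι ℝ :=
  Matrix.of fun i j => pd i (fun q => pd j f q) p

end PseudoRiemannian

/-! The geometry of the product. A point `(x, y)` of `ℝᵈ × ℝᵈ` is `Sum.elim x y`, and the index
`Sum.inl i` is the unbarred index `i`, the index `Sum.inr j` is the barred index `j`. -/

variable {d : ℕ}

/-- The point `(x, y(x))`. -/
def emb (y : (Fin d → ℝ) → Fin d → ℝ) (x : Fin d → ℝ) : Fin d ⊕ Fin d → ℝ :=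
  Sum.elim x (y x)

/-- The matrix `D²_{xy} c` of mixed partial derivatives `∂ᵢ ∂_{j̄} c` at `p = (x, y)`. -/
noncomputable def mixedHess (c : (Fin d → ℝ) → (Fin d → ℝ) → ℝ) (p : Fin d ⊕ Fin d → ℝ) :
    Matrix (Fin d) (Fin d) ℝ :=
  Matrix.of fun i j =>
    pd (Sum.inl i) (fun q => pd (Sum.inr j) (fun r => c (r ∘ Sum.inl) (r ∘ Sum.inr)) q) p

/-- The Kim-McCann metric of the cost `c`. -/
noncomputable def kmMetric (c : (Fin d → ℝ) → (Fin d → ℝ) → ℝ) (p : Fin d ⊕ Fin d → ℝ) :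
    Matrix (Fin d ⊕ Fin d) (Fin d ⊕ Fin d) ℝ :=
  Matrix.fromBlocks 0 ((-(1 / 2) : ℝ) • mixedHess c p)
    ((-(1 / 2) : ℝ) • (mixedHess c p).transpose) 0

/-- The para-complex structure `K(ξ, η) = (ξ, -η)`. -/
def paraK (v : Fin d ⊕ Fin d → ℝ) : Fin d ⊕ Fin d → ℝ :=
  Sum.elim (fun i => v (Sum.inl i)) (fun j => -v (Sum.inr j))

/-- The derivative `∂ᵢ y^{j̄}` at `x`. -/
noncomputable def dy (y : (Fin d → ℝ) → Fin d → ℝ) (i j : Fin d) (x : Fin d → ℝ) : ℝ :=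
  pd i (fun s => y s j) x

/-- The vector fields `tᵢ = eᵢ + ∂ᵢ y^{j̄} e_{j̄}`: on `Σ` they are the pushforwards of the
coordinate fields under `x ↦ (x, y(x))`; they are extended off `Σ` independently of the second
variable. -/
noncomputable def tanField (y : (Fin d → ℝ) → Fin d → ℝ) (i : Fin d)
    (p : Fin d ⊕ Fin d → ℝ) : Fin d ⊕ Fin d → ℝ :=
  Sum.elim (Pi.single i 1) (fun j => dy y i j (p ∘ Sum.inl))

/-- The metric `gᵢⱼ(x) = g̃(tᵢ, tⱼ)` induced on `Σ`, in the coordinates `x`. -/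
noncomputable def indMetric (c : (Fin d → ℝ) → (Fin d → ℝ) → ℝ)
    (y : (Fin d → ℝ) → Fin d → ℝ) (x : Fin d → ℝ) : Matrix (Fin d) (Fin d) ℝ :=
  Matrix.of fun i j =>
    pairing (kmMetric c (emb y x)) (tanField y i (emb y x)) (tanField y j (emb y x))

/-- The `g̃`-orthogonal projection of `v` onto the tangent space of `Σ` at `(x, y(x))`. -/
noncomputable def tanProj (c : (Fin d → ℝ) → (Fin d → ℝ) → ℝ) (y : (Fin d → ℝ) → Fin d → ℝ)
    (x : Fin d → ℝ) (v : Fin d ⊕ Fin d → ℝ) : Fin d ⊕ Fin d → ℝ :=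
  ∑ k, ∑ l, ((indMetric c y x)⁻¹ k l *
    pairing (kmMetric c (emb y x)) v (tanField y l (emb y x))) • tanField y k (emb y x)

/-- The second fundamental form `h(U, V)` at `(x, y(x))`: the normal part of the Levi-Civita
derivative of `V` along `U` for the Kim-McCann metric (`U`, `V` tangent to `Σ`). -/
noncomputable def secondFF (c : (Fin d → ℝ) → (Fin d → ℝ) → ℝ)
    (y : (Fin d → ℝ) → Fin d → ℝ) (U V : (Fin d ⊕ Fin d → ℝ) → Fin d ⊕ Fin d → ℝ)
    (x : Fin d → ℝ) : Fin d ⊕ Fin d → ℝ :=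
  covDeriv (kmMetric c) U V (emb y x) - tanProj c y x (covDeriv (kmMetric c) U V (emb y x))

/-- The components `h_{ijk} = g̃(K h(tᵢ, tⱼ), t_k)`. -/
noncomputable def hCov (c : (Fin d → ℝ) → (Fin d → ℝ) → ℝ) (y : (Fin d → ℝ) → Fin d → ℝ)
    (i j k : Fin d) (x : Fin d → ℝ) : ℝ :=
  pairing (kmMetric c (emb y x)) (paraK (secondFF c y (tanField y i) (tanField y j) x))
    (tanField y k (emb y x))

/-- The mean curvature `H`, the trace of `h` with respect to `g`, a normal vector. -/
noncomputable def meanCurv (c : (Fin d → ℝ) → (Fin d → ℝ) → ℝ)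
    (y : (Fin d → ℝ) → Fin d → ℝ) (x : Fin d → ℝ) : Fin d ⊕ Fin d → ℝ :=
  ∑ i, ∑ j, (indMetric c y x)⁻¹ i j • secondFF c y (tanField y i) (tanField y j) x

/-- `⟨H, H⟩`, for the Kim-McCann metric. -/
noncomputable def normSqH (c : (Fin d → ℝ) → (Fin d → ℝ) → ℝ)
    (y : (Fin d → ℝ) → Fin d → ℝ) (x : Fin d → ℝ) : ℝ :=
  pairing (kmMetric c (emb y x)) (meanCurv c y x) (meanCurv c y x)

/-- `⟨h, h⟩ = g^{ik} g^{jl} g̃(h(tᵢ, tⱼ), h(t_k, t_l))`. -/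
noncomputable def normSqh (c : (Fin d → ℝ) → (Fin d → ℝ) → ℝ)
    (y : (Fin d → ℝ) → Fin d → ℝ) (x : Fin d → ℝ) : ℝ :=
  ∑ i, ∑ j, ∑ k, ∑ l, (indMetric c y x)⁻¹ i k * (indMetric c y x)⁻¹ j l *
    pairing (kmMetric c (emb y x)) (secondFF c y (tanField y i) (tanField y j) x)
      (secondFF c y (tanField y k) (tanField y l) x)

/-- The `c`-divergence `u(x, y) = c(x, y) - φ(x) - ψ(y)`. -/
def cDiv (c : (Fin d → ℝ) → (Fin d → ℝ) → ℝ) (φ ψ : (Fin d → ℝ) → ℝ) (x y : Fin d → ℝ) : ℝ :=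
  c x y - φ x - ψ y

/-- The matrix `u_{ij}` of second derivatives in `x`, on `Σ`. -/
noncomputable def uHessX (c : (Fin d → ℝ) → (Fin d → ℝ) → ℝ) (φ ψ : (Fin d → ℝ) → ℝ)
    (y : (Fin d → ℝ) → Fin d → ℝ) (x : Fin d → ℝ) : Matrix (Fin d) (Fin d) ℝ :=
  hess (fun s => cDiv c φ ψ s (y x)) x

/-- The matrix `u_{īj̄}` of second derivatives in `y`, on `Σ`. -/
noncomputable def uHessY (c : (Fin d → ℝ) → (Fin d → ℝ) → ℝ) (φ ψ : (Fin d → ℝ) → ℝ)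
    (y : (Fin d → ℝ) → Fin d → ℝ) (x : Fin d → ℝ) : Matrix (Fin d) (Fin d) ℝ :=
  hess (fun s => cDiv c φ ψ x s) (y x)

end KimMcCann

/-! Write D = (∂ᵢy^j̄), C = D²_{xy}c, U = (u_{ij}) and W = (u_{īj̄}) on Σ. Since u ≥ 0 vanishes on
Σ, each point of Σ minimises u in x and in y, so c_j = φ_j and c_j̄ = ψ_j̄ along the graph.
Differentiating these identities along x ↦ (x, y(x)) gives U = -D Cᵀ and C = -D W (`uHessX_eq`,
`mixedHess_eq`). Hence the induced metric is U itself (`indMetric_eq`); definiteness makes U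
invertible, hence also C, and so g̃ is nondegenerate on Σ.

Three facts then combine. (1) The Gauss equation holds for any nondegenerate immersion F
(`gauss_equation`). Its core is `sum_riem_velocity_eq`: the ambient curvature on tangent vectors
equals derivatives of the lowered Christoffel symbols of the induced metric plus products of the
fields ∇ᵢtⱼ. For F = id this is the usual coordinate formula, so applying it to the graph and to g
itself leaves only products, whose difference is the product of normal parts. (2) g̃ is para-Kähler:
the x- and y-directions span parallel null distributions. So R̃ vanishes unless its first and its
second index pair are both of mixed type, and four terms of R̃(tᵢ, tⱼ, t_k, t_l) survive
(`riem_eq_zero_left`, `riem_eq_zero_right`, `sum_tanField`). (3) K carries normal vectors to tangent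
vectors and reverses the sign of g̃ (`pairing_normal`). This turns ⟨h, h⟩-products into -h h u^{st}
and accounts for the signs in the first identity.

For the second identity the first is traced with g⁻¹ = U⁻¹. From the matrix identities, W⁻¹ = Dᵀ U⁻¹
D, and the off-diagonal blocks of g̃⁻¹ are 2 U⁻¹ D and its transpose. So two of the four terms each
trace to the left-hand side and the other two each to R̃/8 (`traced_gauss`). -/

set_option linter.unusedSectionVars false

open Filter Topology

namespace KimMcCann

/-! ### Calculus of partial derivatives -/

section Calculus

variable {ι κ : Type} [Fintype ι] [DecidableEq ι] [Fintype κ] [DecidableEq κ]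

lemma pd_congr {a : ι} {f g : (ι → ℝ) → ℝ} {p : ι → ℝ} (h : f =ᶠ[𝓝 p] g) :
    pd a f p = pd a g p := by
  unfold pd; rw [h.fderiv_eq]

lemma pd_eventuallyEq (a : ι) {f g : (ι → ℝ) → ℝ} {p : ι → ℝ} (h : f =ᶠ[𝓝 p] g) :
    pd a f =ᶠ[𝓝 p] pd a g :=
  h.eventuallyEq_nhds.mono fun _ hq => pd_congr hq

@[simp] lemma pd_const (a : ι) (r : ℝ) (p : ι → ℝ) : pd a (fun _ => r) p = 0 := by
  simp [pd]

lemma pd_apply (a b : ι) (p : ι → ℝ) :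
    pd a (fun q => q b) p = (Pi.single a 1 : ι → ℝ) b := by
  unfold pd
  rw [(hasFDerivAt_apply b p).fderiv]
  rfl

lemma pd_add {a : ι} {f g : (ι → ℝ) → ℝ} {p : ι → ℝ} (hf : DifferentiableAt ℝ f p)
    (hg : DifferentiableAt ℝ g p) : pd a (fun q => f q + g q) p = pd a f p + pd a g p := by
  unfold pd; rw [fderiv_fun_add hf hg]; rfl

lemma pd_sub {a : ι} {f g : (ι → ℝ) → ℝ} {p : ι → ℝ} (hf : DifferentiableAt ℝ f p)
    (hg : DifferentiableAt ℝ g p) : pd a (fun q => f q - g q) p = pd a f p - pd a g p := by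
  unfold pd; rw [fderiv_fun_sub hf hg]; rfl

lemma pd_mul {a : ι} {f g : (ι → ℝ) → ℝ} {p : ι → ℝ} (hf : DifferentiableAt ℝ f p)
    (hg : DifferentiableAt ℝ g p) :
    pd a (fun q => f q * g q) p = pd a f p * g p + f p * pd a g p := by
  unfold pd; rw [fderiv_fun_mul hf hg]; simp; ring

lemma pd_const_mul {a : ι} {f : (ι → ℝ) → ℝ} {p : ι → ℝ} (r : ℝ)
    (hf : DifferentiableAt ℝ f p) : pd a (fun q => r * f q) p = r * pd a f p := by
  rw [pd_mul (by fun_prop) hf]; simp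

lemma pd_sum {σ : Type} (s : Finset σ) {a : ι} {f : σ → (ι → ℝ) → ℝ} {p : ι → ℝ}
    (hf : ∀ i ∈ s, DifferentiableAt ℝ (f i) p) :
    pd a (fun q => ∑ i ∈ s, f i q) p = ∑ i ∈ s, pd a (f i) p := by
  unfold pd; rw [fderiv_fun_sum hf]; simp

lemma contDiffAt_pd {a : ι} {f : (ι → ℝ) → ℝ} {p : ι → ℝ} {m n : WithTop ℕ∞}
    (hf : ContDiffAt ℝ n f p) (h : m + 1 ≤ n) : ContDiffAt ℝ m (pd a f) p :=
  (hf.fderiv_right h).clm_apply contDiffAt_const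

lemma pd_comm {a b : ι} {f : (ι → ℝ) → ℝ} {p : ι → ℝ} (hf : ContDiffAt ℝ 2 f p) :
    pd a (pd b f) p = pd b (pd a f) p := by
  have hs : IsSymmSndFDerivAt ℝ f p := hf.isSymmSndFDerivAt (by simp)
  have hd : DifferentiableAt ℝ (fderiv ℝ f) p :=
    (hf.fderiv_right (m := 1) (by norm_num)).differentiableAt (by norm_num)
  have key : ∀ a b : ι, pd a (pd b f) p
      = fderiv ℝ (fderiv ℝ f) p (Pi.single a 1) (Pi.single b 1) := by
    intro a b
    unfold pd
    rw [fderiv_clm_apply hd (by fun_prop)]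
    simp
  rw [key, key, hs]

lemma pd_comp {i : ι} {f : (κ → ℝ) → ℝ} {F : (ι → ℝ) → κ → ℝ} {x : ι → ℝ}
    (hf : DifferentiableAt ℝ f (F x)) (hF : ∀ a, DifferentiableAt ℝ (fun s => F s a) x) :
    pd i (fun s => f (F s)) x = ∑ a, pd a f (F x) * pd i (fun s => F s a) x := by
  have hF' : DifferentiableAt ℝ F x := differentiableAt_pi.2 hF
  unfold pd
  have h1 : fderiv ℝ (fun s => f (F s)) x = (fderiv ℝ f (F x)).comp (fderiv ℝ F x) :=
    fderiv_comp x hf hF'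
  have h2 : fderiv ℝ F x (Pi.single i 1)
      = ∑ a, (fderiv ℝ (fun s => F s a) x (Pi.single i 1)) • (Pi.single a 1 : κ → ℝ) := by
    ext b
    rw [fderiv_pi hF]
    simp [Finset.sum_apply, Pi.single_apply]
  rw [h1, ContinuousLinearMap.comp_apply, h2, map_sum]
  simp [mul_comm]

end Calculus

/-! ### Bilinearity of the pairing -/

section Pairing

variable {ι : Type} [Fintype ι]

lemma pairing_eq (G : Matrix ι ι ℝ) (v w : ι → ℝ) : pairing G v w = v ⬝ᵥ G.mulVec w := by
  simp only [pairing, dotProduct, Matrix.mulVec, Finset.mul_sum]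
  refine Finset.sum_congr rfl fun a _ => Finset.sum_congr rfl fun b _ => by ring

lemma pairing_comm {G : Matrix ι ι ℝ} (hG : G.IsSymm) (v w : ι → ℝ) :
    pairing G v w = pairing G w v := by
  unfold pairing
  rw [Finset.sum_comm]
  refine Finset.sum_congr rfl fun a _ => Finset.sum_congr rfl fun b _ => ?_
  rw [hG.apply a b]; ring

lemma pairing_sub_left (G : Matrix ι ι ℝ) (v v' w : ι → ℝ) :
    pairing G (v - v') w = pairing G v w - pairing G v' w := by
  simp [pairing_eq, sub_dotProduct]

lemma pairing_sub_right (G : Matrix ι ι ℝ) (v w w' : ι → ℝ) :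
    pairing G v (w - w') = pairing G v w - pairing G v w' := by
  simp [pairing_eq, Matrix.mulVec_sub]

lemma pairing_smul_left (G : Matrix ι ι ℝ) (r : ℝ) (v w : ι → ℝ) :
    pairing G (r • v) w = r * pairing G v w := by
  simp [pairing_eq]

lemma pairing_smul_right (G : Matrix ι ι ℝ) (r : ℝ) (v w : ι → ℝ) :
    pairing G v (r • w) = r * pairing G v w := by
  simp [pairing_eq, Matrix.mulVec_smul]

lemma pairing_sum_left {σ : Type} (G : Matrix ι ι ℝ) (s : Finset σ) (v : σ → ι → ℝ) (w : ι → ℝ) :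
    pairing G (∑ i ∈ s, v i) w = ∑ i ∈ s, pairing G (v i) w := by
  simp [pairing_eq, sum_dotProduct]

lemma pairing_sum_right {σ : Type} (G : Matrix ι ι ℝ) (s : Finset σ) (v : ι → ℝ) (w : σ → ι → ℝ) :
    pairing G v (∑ i ∈ s, w i) = ∑ i ∈ s, pairing G v (w i) := by
  simp [pairing_eq, dotProduct_sum, Matrix.mulVec_sum]

end Pairing

/-! ### Levi-Civita connection and curvature in coordinates -/

section Metric

variable {ι κ : Type} [Fintype ι] [DecidableEq ι] [Fintype κ] [DecidableEq κ]

/-- The matrix-valued function `G` is a `C²` pseudo-Riemannian metric near `p`. -/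
structure IsMetricAt (G : (κ → ℝ) → Matrix κ κ ℝ) (p : κ → ℝ) : Prop where
  smooth : ∀ a b, ContDiffAt ℝ 2 (fun q => G q a b) p
  symm : ∀ᶠ q in 𝓝 p, (G q).IsSymm
  det : (G p).det ≠ 0

lemma contDiffAt_det {n : WithTop ℕ∞} {E : Type} [NormedAddCommGroup E] [NormedSpace ℝ E]
    {M : E → Matrix κ κ ℝ} {p : E}
    (h : ∀ a b, ContDiffAt ℝ n (fun q => M q a b) p) : ContDiffAt ℝ n (fun q => (M q).det) p := by
  simp only [Matrix.det_apply']
  exact ContDiffAt.sum fun σ _ => contDiffAt_const.mul (contDiffAt_prod fun i _ => h _ _)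

/-- By Cramer's rule: the entry is a cofactor divided by the determinant, and a cofactor is the
determinant of the matrix with one row replaced by a constant one. -/
lemma contDiffAt_inv_entry {n : WithTop ℕ∞} {E : Type} [NormedAddCommGroup E] [NormedSpace ℝ E]
    {M : E → Matrix κ κ ℝ} {p : E}
    (h : ∀ a b, ContDiffAt ℝ n (fun q => M q a b) p) (hp : (M p).det ≠ 0) (a b : κ) :
    ContDiffAt ℝ n (fun q => (M q)⁻¹ a b) p := by
  simp only [Matrix.inv_def, Matrix.smul_apply, Ring.inverse_eq_inv', smul_eq_mul]
  refine ((contDiffAt_det h).inv hp).mul ?_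
  simp only [Matrix.adjugate_apply]
  refine contDiffAt_det fun i j => ?_
  by_cases hi : i = b
  · subst hi; simp only [Matrix.updateRow_self]; exact contDiffAt_const
  · simp only [Matrix.updateRow_ne hi]; exact h i j

lemma IsMetricAt.eventually {G : (κ → ℝ) → Matrix κ κ ℝ} {p : κ → ℝ} (h : IsMetricAt G p) :
    ∀ᶠ q in 𝓝 p, IsMetricAt G q := by
  have h1 : ∀ᶠ q in 𝓝 p, ∀ a b, ContDiffAt ℝ 2 (fun q => G q a b) q :=
    eventually_all.2 fun a => eventually_all.2 fun b => (h.smooth a b).eventually (by simp)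
  have h2 : ∀ᶠ q in 𝓝 p, (G q).det ≠ 0 :=
    (contDiffAt_det h.smooth).continuousAt.eventually_ne h.det
  filter_upwards [h1, h.symm.eventually_nhds, h2] with q a b c using ⟨a, b, c⟩

lemma IsMetricAt.differentiableAt {G : (κ → ℝ) → Matrix κ κ ℝ} {p : κ → ℝ}
    (h : IsMetricAt G p) (a b : κ) : DifferentiableAt ℝ (fun q => G q a b) p :=
  (h.smooth a b).differentiableAt (by norm_num)

lemma IsMetricAt.pd_symm {G : (κ → ℝ) → Matrix κ κ ℝ} {p : κ → ℝ}
    (h : IsMetricAt G p) (e a b : κ) : pd e (fun q => G q a b) p = pd e (fun q => G q b a) p :=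
  pd_congr (h.symm.mono fun _ hq => hq.apply b a)

/-- Christoffel symbols of the first kind `Γ_{ij,l}`. -/
noncomputable def christoffelLow (G : (κ → ℝ) → Matrix κ κ ℝ) (i j l : κ) (p : κ → ℝ) : ℝ :=
  1 / 2 * (pd i (fun q => G q j l) p + pd j (fun q => G q i l) p - pd l (fun q => G q i j) p)

lemma christoffel_eq (G : (κ → ℝ) → Matrix κ κ ℝ) (k i j : κ) (p : κ → ℝ) :
    christoffel G k i j p = ∑ l, (G p)⁻¹ k l * christoffelLow G i j l p := by
  simp only [christoffel, christoffelLow, Finset.mul_sum]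
  exact Finset.sum_congr rfl fun _ _ => by ring

lemma sum_mul_christoffel {G : (κ → ℝ) → Matrix κ κ ℝ} {p : κ → ℝ} (h : (G p).det ≠ 0)
    (i j l : κ) : ∑ k, G p l k * christoffel G k i j p = christoffelLow G i j l p := by
  have h1 : (G p).mulVec ((G p)⁻¹.mulVec fun l => christoffelLow G i j l p) l
      = christoffelLow G i j l p := by
    rw [Matrix.mulVec_mulVec, Matrix.mul_nonsing_inv _ (Ne.isUnit h), Matrix.one_mulVec]
  rw [← h1]
  simp only [Matrix.mulVec, dotProduct, christoffel_eq]

lemma IsMetricAt.christoffelLow_symm {G : (κ → ℝ) → Matrix κ κ ℝ} {p : κ → ℝ}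
    (h : IsMetricAt G p) (i j l : κ) : christoffelLow G i j l p = christoffelLow G j i l p := by
  unfold christoffelLow
  rw [h.pd_symm l i j]; ring

lemma IsMetricAt.christoffel_symm {G : (κ → ℝ) → Matrix κ κ ℝ} {p : κ → ℝ}
    (h : IsMetricAt G p) (k i j : κ) : christoffel G k i j p = christoffel G k j i p := by
  simp only [christoffel_eq, h.christoffelLow_symm i j]

/-- Metric compatibility ∇g = 0 with all indices lowered: the two differences of derivatives cancel
in the sum. -/
lemma IsMetricAt.christoffelLow_add {G : (κ → ℝ) → Matrix κ κ ℝ} {p : κ → ℝ}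
    (h : IsMetricAt G p) (e a b : κ) :
    christoffelLow G e a b p + christoffelLow G e b a p = pd e (fun q => G q a b) p := by
  unfold christoffelLow
  rw [h.pd_symm e b a, h.pd_symm a e b, h.pd_symm b e a, h.pd_symm a b e, h.pd_symm b a e]; ring

lemma IsMetricAt.contDiffAt_christoffelLow {G : (κ → ℝ) → Matrix κ κ ℝ} {p : κ → ℝ}
    (h : IsMetricAt G p) (i j l : κ) : ContDiffAt ℝ 1 (christoffelLow G i j l) p := by
  have h1 : ∀ a b e, ContDiffAt ℝ 1 (pd e fun q => G q a b) p := fun a b e =>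
    contDiffAt_pd (h.smooth a b) (by norm_num)
  exact contDiffAt_const.mul (((h1 _ _ _).add (h1 _ _ _)).sub (h1 _ _ _))

lemma IsMetricAt.contDiffAt_christoffel {G : (κ → ℝ) → Matrix κ κ ℝ} {p : κ → ℝ}
    (h : IsMetricAt G p) (k i j : κ) : ContDiffAt ℝ 1 (christoffel G k i j) p := by
  have : christoffel G k i j = fun p => ∑ l, (G p)⁻¹ k l * christoffelLow G i j l p :=
    funext fun p => christoffel_eq G k i j p
  rw [this]
  exact ContDiffAt.sum fun l _ =>
    ((contDiffAt_inv_entry h.smooth h.det k l).of_le (by norm_num)).mul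
      (h.contDiffAt_christoffelLow i j l)

lemma covDeriv_coordField (G : (κ → ℝ) → Matrix κ κ ℝ) (b : κ) (W : (κ → ℝ) → κ → ℝ)
    (p : κ → ℝ) (k : κ) : covDeriv G (coordField b) W p k
      = pd b (fun q => W q k) p + ∑ m, christoffel G k b m p * W p m := by
  simp [covDeriv, coordField, Pi.single_apply]

/-- The components of ∇_{eₐ} e_c are Christoffel symbols, and coordinate fields commute, so the
bracket term drops out. -/
lemma curvature_coordField_apply {G : (κ → ℝ) → Matrix κ κ ℝ} {p : κ → ℝ}
    (a b c k : κ) :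
    curvature G (coordField a) (coordField b) (coordField c) p k
      = pd b (christoffel G k a c) p - pd a (christoffel G k b c) p
        + ∑ m, (christoffel G k b m p * christoffel G m a c p
          - christoffel G k a m p * christoffel G m b c p) := by
  have h1 : ∀ a c, covDeriv G (coordField a) (coordField c) = fun q k => christoffel G k a c q := by
    intro a c
    ext q k
    rw [covDeriv_coordField]
    simp [coordField, Pi.single_apply]
  have h2 : VectorField.lieBracket ℝ (coordField b) (coordField a) = fun _ : κ → ℝ => 0 := by
    ext q k
    have h0 : ∀ a : κ, fderiv ℝ (coordField a : (κ → ℝ) → κ → ℝ) q = 0 := fun a => by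
      unfold coordField; simp
    simp [VectorField.lieBracket, h0]
  have h3 : covDeriv G (fun _ => 0) (coordField c) p = 0 := by
    ext k; simp [covDeriv]
  simp only [curvature, h1, h2, h3, Pi.sub_apply, covDeriv_coordField, Pi.zero_apply,
    Finset.sum_sub_distrib]
  ring

end Metric

/-! ### Covariant differentiation along a map -/

section AlongMap

variable {ι κ : Type} [Fintype ι] [DecidableEq ι] [Fintype κ] [DecidableEq κ]

/-- The coordinate tangent vector `∂ᵢ F`. -/
noncomputable def velocity (F : (ι → ℝ) → κ → ℝ) (i : ι) (x : ι → ℝ) : κ → ℝ :=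
  fun a => pd i (fun s => F s a) x

/-- The connection matrix, along the map `F`, of the Levi-Civita connection of `G`. -/
noncomputable def connMat (G : (κ → ℝ) → Matrix κ κ ℝ) (F : (ι → ℝ) → κ → ℝ) (i : ι) (k c : κ)
    (x : ι → ℝ) : ℝ :=
  ∑ b, christoffel G k b c (F x) * velocity F i x b

/-- The covariant derivative in the direction `∂ᵢ` of a vector field along the map `F`. -/
noncomputable def alongDeriv (G : (κ → ℝ) → Matrix κ κ ℝ) (F : (ι → ℝ) → κ → ℝ) (i : ι)
    (V : (ι → ℝ) → κ → ℝ) (x : ι → ℝ) : κ → ℝ :=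
  fun k => pd i (fun s => V s k) x + ∑ c, connMat G F i k c x * V x c

/-- The metric induced by the map `F`. -/
noncomputable def pullback (G : (κ → ℝ) → Matrix κ κ ℝ) (F : (ι → ℝ) → κ → ℝ) (x : ι → ℝ) :
    Matrix ι ι ℝ :=
  Matrix.of fun i j => pairing (G (F x)) (velocity F i x) (velocity F j x)

lemma sum_comm_outer {α β γ : Type} [Fintype α] [Fintype β] [Fintype γ] (f : α → β → γ → ℝ) :
    ∑ a, ∑ b, ∑ c, f a b c = ∑ c, ∑ b, ∑ a, f a b c := by
  rw [Finset.sum_comm, Finset.sum_comm (s := Finset.univ (α := γ))]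
  exact Finset.sum_congr rfl fun b _ => Finset.sum_comm

/-- Metric compatibility along F. The chain rule produces the derivative of G contracted with the
velocity; `christoffelLow_add` splits it into two connection terms, one for each argument of the
pairing. -/
lemma pd_pairing {G : (κ → ℝ) → Matrix κ κ ℝ} {F : (ι → ℝ) → κ → ℝ} {x : ι → ℝ}
    (hG : IsMetricAt G (F x)) (hF : ∀ a, DifferentiableAt ℝ (fun s => F s a) x)
    {V W : (ι → ℝ) → κ → ℝ} (hV : ∀ a, DifferentiableAt ℝ (fun s => V s a) x)
    (hW : ∀ a, DifferentiableAt ℝ (fun s => W s a) x) (i : ι) :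
    pd i (fun s => pairing (G (F s)) (V s) (W s)) x
      = pairing (G (F x)) (alongDeriv G F i V x) (W x)
        + pairing (G (F x)) (V x) (alongDeriv G F i W x) := by
  have hF' : DifferentiableAt ℝ F x := differentiableAt_pi.2 hF
  have hGF : ∀ a b, DifferentiableAt ℝ (fun s => G (F s) a b) x := fun a b =>
    (hG.differentiableAt a b).comp x hF'
  have hprod : ∀ a b, DifferentiableAt ℝ (fun s => G (F s) a b * V s a) x := fun a b =>
    (hGF a b).fun_mul (hV a)
  have hsymm : (G (F x)).IsSymm := hG.symm.self_of_nhds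
  have e1 : pd i (fun s => pairing (G (F s)) (V s) (W s)) x
      = ∑ a, ∑ b, ((∑ e, pd e (fun q => G q a b) (F x) * velocity F i x e) * V x a * W x b
        + G (F x) a b * pd i (fun s => V s a) x * W x b
        + G (F x) a b * V x a * pd i (fun s => W s b) x) := by
    unfold pairing
    rw [pd_sum _ fun a _ => DifferentiableAt.fun_sum fun b _ => (hprod a b).fun_mul (hW b)]
    refine Finset.sum_congr rfl fun a _ => ?_
    rw [pd_sum _ fun b _ => (hprod a b).fun_mul (hW b)]
    refine Finset.sum_congr rfl fun b _ => ?_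
    rw [pd_mul (hprod a b) (hW b), pd_mul (hGF a b) (hV a),
      pd_comp (f := fun q => G q a b) (hG.differentiableAt a b) hF]
    simp only [velocity]
    ring
  have e2 : ∀ a b, (∑ e, pd e (fun q => G q a b) (F x) * velocity F i x e)
      = (∑ m, G (F x) m b * connMat G F i m a x) + ∑ m, G (F x) a m * connMat G F i m b x := by
    intro a b
    simp only [connMat, Finset.mul_sum]
    rw [Finset.sum_comm (γ := κ), Finset.sum_comm (γ := κ) (f := fun m e => G (F x) a m * _)]
    rw [← Finset.sum_add_distrib]
    refine Finset.sum_congr rfl fun e _ => ?_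
    rw [← hG.christoffelLow_add e a b, ← sum_mul_christoffel hG.det,
      ← sum_mul_christoffel hG.det, add_mul, Finset.sum_mul, Finset.sum_mul]
    congr 1
    · refine Finset.sum_congr rfl fun m _ => ?_
      rw [hsymm.apply m b]; ring
    · exact Finset.sum_congr rfl fun m _ => by ring
  have e3 : pairing (G (F x)) (alongDeriv G F i V x) (W x)
      = ∑ a, ∑ b, (G (F x) a b * pd i (fun s => V s a) x * W x b
        + (∑ m, G (F x) m b * connMat G F i m a x) * V x a * W x b) := by
    simp only [Finset.sum_add_distrib, pairing, alongDeriv, mul_add, add_mul, Finset.sum_mul,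
      Finset.mul_sum]
    congr 1
    rw [sum_comm_outer]
    exact Finset.sum_congr rfl fun a _ => Finset.sum_congr rfl fun b _ =>
      Finset.sum_congr rfl fun m _ => by ring
  have e4 : pairing (G (F x)) (V x) (alongDeriv G F i W x)
      = ∑ a, ∑ b, (G (F x) a b * V x a * pd i (fun s => W s b) x
        + (∑ m, G (F x) a m * connMat G F i m b x) * V x a * W x b) := by
    simp only [Finset.sum_add_distrib, pairing, alongDeriv, mul_add, Finset.sum_mul,
      Finset.mul_sum]
    congr 1
    refine Finset.sum_congr rfl fun a _ => ?_
    rw [Finset.sum_comm]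
    exact Finset.sum_congr rfl fun b _ => Finset.sum_congr rfl fun m _ => by ring
  rw [e1, e3, e4, ← Finset.sum_add_distrib]
  refine Finset.sum_congr rfl fun a _ => ?_
  rw [← Finset.sum_add_distrib]
  refine Finset.sum_congr rfl fun b _ => ?_
  rw [e2]; ring

end AlongMap

/-! ### The Gauss equation for an immersion -/

section Gauss

variable {ι κ : Type} [Fintype ι] [DecidableEq ι] [Fintype κ] [DecidableEq κ]

lemma contDiffAt_velocity {F : (ι → ℝ) → κ → ℝ} {x : ι → ℝ} {m n : WithTop ℕ∞}
    (hF : ∀ a, ContDiffAt ℝ n (fun s => F s a) x) (h : m + 1 ≤ n) (i : ι) (a : κ) :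
    ContDiffAt ℝ m (fun s => velocity F i s a) x :=
  contDiffAt_pd (hF a) h

lemma IsMetricAt.contDiffAt_christoffel_comp {G : (κ → ℝ) → Matrix κ κ ℝ}
    {F : (ι → ℝ) → κ → ℝ} {x : ι → ℝ} (hG : IsMetricAt G (F x))
    (hF : ∀ a, ContDiffAt ℝ 2 (fun s => F s a) x) (k b c : κ) :
    ContDiffAt ℝ 1 (fun s => christoffel G k b c (F s)) x := by
  have hF1 : ContDiffAt ℝ 1 F x := contDiffAt_pi.2 fun a => (hF a).of_le (by norm_num)
  exact (hG.contDiffAt_christoffel k b c).comp x hF1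

lemma IsMetricAt.contDiffAt_connMat {G : (κ → ℝ) → Matrix κ κ ℝ}
    {F : (ι → ℝ) → κ → ℝ} {x : ι → ℝ} (hG : IsMetricAt G (F x))
    (hF : ∀ a, ContDiffAt ℝ 2 (fun s => F s a) x) (i : ι) (k c : κ) :
    ContDiffAt ℝ 1 (connMat G F i k c) x :=
  ContDiffAt.sum fun b _ => (hG.contDiffAt_christoffel_comp hF k b c).mul
    (contDiffAt_velocity hF (by norm_num) i b)

lemma IsMetricAt.contDiffAt_alongDeriv {G : (κ → ℝ) → Matrix κ κ ℝ}
    {F : (ι → ℝ) → κ → ℝ} {x : ι → ℝ} (hG : IsMetricAt G (F x))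
    (hF : ∀ a, ContDiffAt ℝ 2 (fun s => F s a) x) {V : (ι → ℝ) → κ → ℝ}
    (hV : ∀ a, ContDiffAt ℝ 2 (fun s => V s a) x) (i : ι) (k : κ) :
    ContDiffAt ℝ 1 (fun s => alongDeriv G F i V s k) x :=
  (contDiffAt_pd (hV k) (by norm_num)).add (ContDiffAt.sum fun c _ =>
    (hG.contDiffAt_connMat hF i k c).mul ((hV c).of_le (by norm_num)))

/-- Torsion-freeness: second derivatives of F commute and the Christoffel symbols are symmetric in
the lower indices. -/
lemma alongDeriv_velocity_comm {G : (κ → ℝ) → Matrix κ κ ℝ} {F : (ι → ℝ) → κ → ℝ} {x : ι → ℝ}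
    (hG : IsMetricAt G (F x)) (hF : ∀ a, ContDiffAt ℝ 2 (fun s => F s a) x) (i j : ι) :
    alongDeriv G F i (velocity F j) x = alongDeriv G F j (velocity F i) x := by
  ext k
  have h1 : pd i (fun s => velocity F j s k) x = pd j (fun s => velocity F i s k) x :=
    pd_comm (hF k)
  simp only [alongDeriv, h1, connMat, Finset.sum_mul]
  congr 1
  rw [Finset.sum_comm]
  refine Finset.sum_congr rfl fun b _ => Finset.sum_congr rfl fun c _ => ?_
  rw [hG.christoffel_symm k b c]; ring

/-- Koszul's formula for the metric induced by `F`. -/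
lemma pairing_alongDeriv_velocity {G : (κ → ℝ) → Matrix κ κ ℝ} {F : (ι → ℝ) → κ → ℝ}
    {x : ι → ℝ} (hG : IsMetricAt G (F x)) (hF : ∀ a, ContDiffAt ℝ 2 (fun s => F s a) x)
    (i j l : ι) :
    pairing (G (F x)) (alongDeriv G F i (velocity F j) x) (velocity F l x)
      = christoffelLow (pullback G F) i j l x := by
  have hF1 : ∀ a, DifferentiableAt ℝ (fun s => F s a) x := fun a =>
    (hF a).differentiableAt (by norm_num)
  have hv : ∀ i a, DifferentiableAt ℝ (fun s => velocity F i s a) x := fun i a =>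
    (contDiffAt_velocity (m := 1) hF (by norm_num) i a).differentiableAt (by norm_num)
  have hsymm : (G (F x)).IsSymm := hG.symm.self_of_nhds
  -- The Koszul combination of three such derivatives contains six pairings; by torsion-freeness
  -- four cancel and the other two are equal.
  have key : ∀ i j l, pd i (fun s => pullback G F s j l) x
      = pairing (G (F x)) (alongDeriv G F i (velocity F j) x) (velocity F l x)
        + pairing (G (F x)) (alongDeriv G F i (velocity F l) x) (velocity F j x) := by
    intro i j l
    have := pd_pairing hG hF1 (hv j) (hv l) i
    rw [pairing_comm hsymm (velocity F j x)] at this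
    exact this
  unfold christoffelLow
  rw [key, key, key, alongDeriv_velocity_comm hG hF j i, alongDeriv_velocity_comm hG hF l i,
    alongDeriv_velocity_comm hG hF l j]
  ring

/-- The commutator of covariant derivatives along a map is given by the curvature tensor. -/
lemma alongDeriv_commutator {G : (κ → ℝ) → Matrix κ κ ℝ} {F : (ι → ℝ) → κ → ℝ} {x : ι → ℝ}
    (hG : IsMetricAt G (F x)) (hF : ∀ a, ContDiffAt ℝ 2 (fun s => F s a) x)
    {V : (ι → ℝ) → κ → ℝ} (hV : ∀ a, ContDiffAt ℝ 2 (fun s => V s a) x) (i j : ι) (k : κ) :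
    alongDeriv G F j (alongDeriv G F i V) x k - alongDeriv G F i (alongDeriv G F j V) x k
      = ∑ c, (∑ a, ∑ b, velocity F i x a * velocity F j x b *
          curvature G (coordField a) (coordField b) (coordField c) (F x) k) * V x c := by
  have hF1 : ∀ a, DifferentiableAt ℝ (fun s => F s a) x := fun a =>
    (hF a).differentiableAt (by norm_num)
  have hV1 : ∀ a, DifferentiableAt ℝ (fun s => V s a) x := fun a =>
    (hV a).differentiableAt (by norm_num)
  have hv : ∀ i a, DifferentiableAt ℝ (fun s => velocity F i s a) x := fun i a =>
    (contDiffAt_velocity (m := 1) hF (by norm_num) i a).differentiableAt (by norm_num)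
  have hA : ∀ i k c, DifferentiableAt ℝ (connMat G F i k c) x := fun i k c =>
    (hG.contDiffAt_connMat hF i k c).differentiableAt (by norm_num)
  have hpV : ∀ i k, DifferentiableAt ℝ (pd i fun s => V s k) x := fun i k =>
    (contDiffAt_pd (m := 1) (hV k) (by norm_num)).differentiableAt (by norm_num)
  have hΓ : ∀ k b c, DifferentiableAt ℝ (fun s => christoffel G k b c (F s)) x := fun k b c =>
    (hG.contDiffAt_christoffel_comp hF k b c).differentiableAt (by norm_num)
  -- The sum containing first derivatives of V is symmetric in i and j, as is the second derivative
  -- of V. The commutator therefore retains only the terms of order zero in V.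
  have second : ∀ i j, alongDeriv G F j (alongDeriv G F i V) x k
      = pd j (pd i fun s => V s k) x
        + ∑ c, (connMat G F i k c x * pd j (fun s => V s c) x
          + connMat G F j k c x * pd i (fun s => V s c) x)
        + ∑ c, (pd j (connMat G F i k c) x + ∑ e, connMat G F j k e x * connMat G F i e c x)
            * V x c := by
    intro i j
    have h1 : pd j (fun s => alongDeriv G F i V s k) x = pd j (pd i fun s => V s k) x
        + ∑ c, (pd j (connMat G F i k c) x * V x c
          + connMat G F i k c x * pd j (fun s => V s c) x) := by
      unfold alongDeriv
      rw [pd_add (hpV i k) (DifferentiableAt.fun_sum fun c _ => (hA i k c).fun_mul (hV1 c)),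
        pd_sum _ fun c _ => (hA i k c).fun_mul (hV1 c)]
      congr 1
      exact Finset.sum_congr rfl fun c _ => pd_mul (hA i k c) (hV1 c)
    have h2 : ∑ e, connMat G F j k e x * alongDeriv G F i V x e
        = ∑ c, connMat G F j k c x * pd i (fun s => V s c) x
          + ∑ c, (∑ e, connMat G F j k e x * connMat G F i e c x) * V x c := by
      simp only [alongDeriv, mul_add, Finset.sum_add_distrib, Finset.mul_sum, Finset.sum_mul]
      congr 1
      rw [Finset.sum_comm]
      exact Finset.sum_congr rfl fun c _ => Finset.sum_congr rfl fun e _ => by ring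
    have h3 : alongDeriv G F j (alongDeriv G F i V) x k
        = pd j (fun s => alongDeriv G F i V s k) x
          + ∑ e, connMat G F j k e x * alongDeriv G F i V x e := rfl
    rw [h3, h1, h2]
    simp only [add_mul, Finset.sum_add_distrib]
    ring
  -- The last sum contains second derivatives of F and is symmetric in i and j, so it also cancels.
  have hdA : ∀ i j c, pd j (connMat G F i k c) x
      = ∑ a, ∑ b, velocity F i x a * velocity F j x b * pd b (christoffel G k a c) (F x)
        + ∑ a, christoffel G k a c (F x) * pd j (pd i fun s => F s a) x := by
    intro i j c
    have h0 : connMat G F i k c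
        = fun s => ∑ a, christoffel G k a c (F s) * velocity F i s a := rfl
    rw [h0, pd_sum _ fun a _ => (hΓ k a c).fun_mul (hv i a), ← Finset.sum_add_distrib]
    refine Finset.sum_congr rfl fun a _ => ?_
    rw [pd_mul (hΓ k a c) (hv i a),
      pd_comp ((hG.contDiffAt_christoffel k a c).differentiableAt (by norm_num)) hF1,
      Finset.sum_mul]
    congr 1
    exact Finset.sum_congr rfl fun b _ => by simp only [velocity]; ring
  have hAA : ∀ i j c, ∑ e, connMat G F j k e x * connMat G F i e c x
      = ∑ a, ∑ b, velocity F i x a * velocity F j x b *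
          ∑ m, christoffel G k b m (F x) * christoffel G m a c (F x) := by
    intro i j c
    simp only [connMat, Finset.sum_mul, Finset.mul_sum]
    rw [sum_comm_outer, Finset.sum_comm]
    exact Finset.sum_congr rfl fun a _ => Finset.sum_congr rfl fun b _ =>
      Finset.sum_congr rfl fun m _ => by ring
  have hFc : ∀ a, pd j (pd i fun s => F s a) x = pd i (pd j fun s => F s a) x := fun a =>
    pd_comm (hF a)
  have hVc : pd j (pd i fun s => V s k) x = pd i (pd j fun s => V s k) x := pd_comm (hV k)
  -- With A the connection matrix, this is the curvature as ∂ⱼAᵢ - ∂ᵢAⱼ + [Aⱼ, Aᵢ].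
  have hc : ∀ c, ∑ a, ∑ b, velocity F i x a * velocity F j x b *
          curvature G (coordField a) (coordField b) (coordField c) (F x) k
      = (pd j (connMat G F i k c) x + ∑ e, connMat G F j k e x * connMat G F i e c x)
        - (pd i (connMat G F j k c) x + ∑ e, connMat G F i k e x * connMat G F j e c x) := by
    intro c
    rw [hdA, hdA, hAA, hAA]
    simp only [hFc]
    rw [Finset.sum_comm (f := fun a b => velocity F j x a * velocity F i x b *
        pd b (christoffel G k a c) (F x)),
      Finset.sum_comm (f := fun a b => velocity F j x a * velocity F i x b *
        ∑ m, christoffel G k b m (F x) * christoffel G m a c (F x))]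
    simp only [curvature_coordField_apply, Finset.sum_sub_distrib, mul_add,
      mul_sub, Finset.sum_add_distrib, mul_comm (velocity F j x _) (velocity F i x _)]
    ring
  rw [second i j, second j i, hVc]
  simp only [hc, sub_mul, Finset.sum_sub_distrib, Finset.sum_add_distrib]
  ring

lemma sum_riem_velocity {G : (κ → ℝ) → Matrix κ κ ℝ} {F : (ι → ℝ) → κ → ℝ} {x : ι → ℝ}
    (hG : IsMetricAt G (F x)) (hF : ∀ a, ContDiffAt ℝ 3 (fun s => F s a) x) (i j k l : ι) :
    ∑ a, ∑ b, ∑ c, ∑ e, riem G a b c e (F x) * velocity F i x a * velocity F j x b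
        * velocity F k x c * velocity F l x e
      = pairing (G (F x)) (alongDeriv G F j (alongDeriv G F i (velocity F k)) x
          - alongDeriv G F i (alongDeriv G F j (velocity F k)) x) (velocity F l x) := by
  have hF2 : ∀ a, ContDiffAt ℝ 2 (fun s => F s a) x := fun a => (hF a).of_le (by norm_num)
  have h1 : alongDeriv G F j (alongDeriv G F i (velocity F k)) x
      - alongDeriv G F i (alongDeriv G F j (velocity F k)) x
      = ∑ a, ∑ b, ∑ c, (velocity F i x a * velocity F j x b * velocity F k x c) •
        curvature G (coordField a) (coordField b) (coordField c) (F x) := by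
    ext m
    rw [Pi.sub_apply, alongDeriv_commutator hG hF2
      (fun a => contDiffAt_velocity hF (by norm_num) k a) i j m]
    simp only [Finset.sum_apply, Pi.smul_apply, smul_eq_mul, Finset.sum_mul]
    rw [Finset.sum_comm]
    refine Finset.sum_congr rfl fun a _ => ?_
    rw [Finset.sum_comm]
    exact Finset.sum_congr rfl fun b _ => Finset.sum_congr rfl fun c _ => by ring
  have h2 : velocity F l x = ∑ e, velocity F l x e • (coordField e (F x) : κ → ℝ) := by
    ext m; simp [coordField, Finset.sum_apply, Pi.single_apply]
  rw [h1]
  simp only [pairing_sum_left]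
  refine Finset.sum_congr rfl fun a _ => Finset.sum_congr rfl fun b _ =>
    Finset.sum_congr rfl fun c _ => ?_
  conv_rhs => rw [h2]
  rw [pairing_sum_right]
  refine Finset.sum_congr rfl fun e _ => ?_
  rw [pairing_smul_left, pairing_smul_right, riem]
  ring

/-- The curvature of `G` on tangent vectors of `F`, in terms of the Christoffel symbols of the
first kind of the induced metric. -/
theorem sum_riem_velocity_eq {G : (κ → ℝ) → Matrix κ κ ℝ} {F : (ι → ℝ) → κ → ℝ} {x : ι → ℝ}
    (hG : IsMetricAt G (F x)) (hF : ∀ a, ContDiffAt ℝ 3 (fun s => F s a) x) (i j k l : ι) :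
    ∑ a, ∑ b, ∑ c, ∑ e, riem G a b c e (F x) * velocity F i x a * velocity F j x b
        * velocity F k x c * velocity F l x e
      = pd j (christoffelLow (pullback G F) i k l) x - pd i (christoffelLow (pullback G F) j k l) x
        - pairing (G (F x)) (alongDeriv G F i (velocity F k) x) (alongDeriv G F j (velocity F l) x)
        + pairing (G (F x)) (alongDeriv G F j (velocity F k) x)
            (alongDeriv G F i (velocity F l) x) := by
  have hF2 : ∀ a, ContDiffAt ℝ 2 (fun s => F s a) x := fun a => (hF a).of_le (by norm_num)
  have hF1 : ∀ a, DifferentiableAt ℝ (fun s => F s a) x := fun a =>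
    (hF a).differentiableAt (by norm_num)
  have hv : ∀ i a, DifferentiableAt ℝ (fun s => velocity F i s a) x := fun i a =>
    (contDiffAt_velocity (m := 1) hF2 (by norm_num) i a).differentiableAt (by norm_num)
  have hFc : ContinuousAt F x := continuousAt_pi.2 fun a => (hF1 a).continuousAt
  have hnear : ∀ᶠ s in 𝓝 x, IsMetricAt G (F s) ∧ ∀ a, ContDiffAt ℝ 2 (fun s => F s a) s :=
    (hFc.eventually hG.eventually).and
      (eventually_all.2 fun a => (hF2 a).eventually (by simp))
  -- Koszul's formula holds in a whole neighbourhood of x, so it may be differentiated; metric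
  -- compatibility then moves the derivative ∇ⱼ onto t_l. No derivative of a tangential projection
  -- is needed.
  have key : ∀ i j, pairing (G (F x)) (alongDeriv G F j (alongDeriv G F i (velocity F k)) x)
        (velocity F l x)
      = pd j (christoffelLow (pullback G F) i k l) x
        - pairing (G (F x)) (alongDeriv G F i (velocity F k) x)
            (alongDeriv G F j (velocity F l) x) := by
    intro i j
    have h1 : christoffelLow (pullback G F) i k l =ᶠ[𝓝 x] fun s =>
        pairing (G (F s)) (alongDeriv G F i (velocity F k) s) (velocity F l s) :=
      hnear.mono fun s hs => (pairing_alongDeriv_velocity hs.1 hs.2 i k l).symm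
    rw [pd_congr h1, pd_pairing hG hF1 (fun a => (hG.contDiffAt_alongDeriv hF2
      (fun a => contDiffAt_velocity hF (by norm_num) k a) i a).differentiableAt (by norm_num))
      (hv l) j]
    ring
  rw [sum_riem_velocity hG hF, pairing_sub_left, key, key]
  ring

lemma velocity_id (i : κ) (p : κ → ℝ) : velocity (fun q : κ → ℝ => q) i p = Pi.single i 1 := by
  ext a; exact pd_apply i a p

lemma pullback_id (G : (κ → ℝ) → Matrix κ κ ℝ) : pullback G (fun q => q) = G := by
  ext p i j
  simp [pullback, velocity_id, pairing, Pi.single_apply]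

lemma alongDeriv_id (G : (κ → ℝ) → Matrix κ κ ℝ) (i j : κ) (p : κ → ℝ) :
    alongDeriv G (fun q => q) i (velocity (fun q => q) j) p = fun k => christoffel G k i j p := by
  ext k
  simp [alongDeriv, connMat, velocity_id, Pi.single_apply]

/-- The case F = id, where the velocities are the coordinate vectors and the induced metric is G. -/
theorem riem_eq {G : (κ → ℝ) → Matrix κ κ ℝ} {p : κ → ℝ} (hG : IsMetricAt G p) (i j k l : κ) :
    riem G i j k l p
      = pd j (christoffelLow G i k l) p - pd i (christoffelLow G j k l) p
        - pairing (G p) (fun m => christoffel G m i k p) (fun m => christoffel G m j l p)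
        + pairing (G p) (fun m => christoffel G m j k p) (fun m => christoffel G m i l p) := by
  have h := sum_riem_velocity_eq (F := fun q : κ → ℝ => q) hG
    (fun a => by fun_prop) i j k l
  simp only [pullback_id, alongDeriv_id] at h
  rw [← h]
  simp [velocity_id, Pi.single_apply]

lemma pairing_christoffel {G : (κ → ℝ) → Matrix κ κ ℝ} {p : κ → ℝ} (hG : IsMetricAt G p)
    (i j k l : κ) :
    pairing (G p) (fun m => christoffel G m i k p) (fun m => christoffel G m j l p)
      = ∑ s, ∑ t, (G p)⁻¹ s t * christoffelLow G i k s p * christoffelLow G j l t p := by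
  have h : (G p).mulVec (fun m => christoffel G m j l p) = fun s => christoffelLow G j l s p :=
    funext fun s => sum_mul_christoffel hG.det j l s
  rw [pairing_eq, h]
  simp only [dotProduct, christoffel_eq, Finset.sum_mul]
  rw [Finset.sum_comm]
  refine Finset.sum_congr rfl fun s _ => Finset.sum_congr rfl fun t _ => ?_
  rw [(hG.symm.self_of_nhds.inv).apply s t]

lemma riem_swap_left {G : (κ → ℝ) → Matrix κ κ ℝ} {p : κ → ℝ} (hG : IsMetricAt G p)
    (i j k l : κ) : riem G i j k l p = -riem G j i k l p := by
  rw [riem_eq hG, riem_eq hG]; ring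

/-- By `christoffelLow_add`, symmetrising the derivative terms in k and l gives ∂ⱼ∂ᵢ g_{kl} - ∂ᵢ∂ⱼ
g_{kl} = 0; the quadratic terms cancel because the pairing is symmetric. -/
lemma riem_swap_right {G : (κ → ℝ) → Matrix κ κ ℝ} {p : κ → ℝ} (hG : IsMetricAt G p)
    (i j k l : κ) : riem G i j k l p = -riem G i j l k p := by
  have hs : (G p).IsSymm := hG.symm.self_of_nhds
  have hd : ∀ i k l, DifferentiableAt ℝ (christoffelLow G i k l) p := fun i k l =>
    (hG.contDiffAt_christoffelLow i k l).differentiableAt (by norm_num)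
  have h1 : ∀ i j, pd j (christoffelLow G i k l) p + pd j (christoffelLow G i l k) p
      = pd j (pd i fun q => G q k l) p := by
    intro i j
    rw [← pd_add (hd _ _ _) (hd _ _ _)]
    exact pd_congr (hG.eventually.mono fun q hq => hq.christoffelLow_add i k l)
  have h2 := h1 i j
  rw [pd_comm (hG.smooth k l), ← h1 j i] at h2
  rw [riem_eq hG, riem_eq hG, pairing_comm hs (fun m => christoffel G m i k p),
    pairing_comm hs (fun m => christoffel G m j k p)]
  linarith

/-- The part of `v` orthogonal to the image of `F`. -/
noncomputable def normalPart (G : (κ → ℝ) → Matrix κ κ ℝ) (F : (ι → ℝ) → κ → ℝ) (x : ι → ℝ)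
    (v : κ → ℝ) : κ → ℝ :=
  v - ∑ k, ∑ l, ((pullback G F x)⁻¹ k l * pairing (G (F x)) v (velocity F l x)) • velocity F k x

lemma pullback_isSymm {G : (κ → ℝ) → Matrix κ κ ℝ} {F : (ι → ℝ) → κ → ℝ} {x : ι → ℝ}
    (hs : (G (F x)).IsSymm) : (pullback G F x).IsSymm := by
  ext i j; exact pairing_comm hs _ _

lemma pairing_normalPart_velocity {G : (κ → ℝ) → Matrix κ κ ℝ} {F : (ι → ℝ) → κ → ℝ} {x : ι → ℝ}
    (hs : (G (F x)).IsSymm) (hg : (pullback G F x).det ≠ 0) (v : κ → ℝ) (s : ι) :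
    pairing (G (F x)) (normalPart G F x v) (velocity F s x) = 0 := by
  rw [normalPart, pairing_sub_left]
  simp only [pairing_sum_left, pairing_smul_left]
  set w : ι → ℝ := fun l => pairing (G (F x)) v (velocity F l x) with hw
  have h1 : (pullback G F x).mulVec ((pullback G F x)⁻¹.mulVec w) s = w s := by
    rw [Matrix.mulVec_mulVec, Matrix.mul_nonsing_inv _ (Ne.isUnit hg), Matrix.one_mulVec]
  have h2 : ∑ k, ∑ l, (pullback G F x)⁻¹ k l * w l
        * pairing (G (F x)) (velocity F k x) (velocity F s x)
      = (pullback G F x).mulVec ((pullback G F x)⁻¹.mulVec w) s := by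
    simp only [Matrix.mulVec, dotProduct, Finset.mul_sum]
    refine Finset.sum_congr rfl fun k _ => Finset.sum_congr rfl fun l _ => ?_
    rw [← (pullback_isSymm hs).apply s k]
    simp only [pullback, Matrix.of_apply]
    ring
  change w s - ∑ k, ∑ l, (pullback G F x)⁻¹ k l * w l
        * pairing (G (F x)) (velocity F k x) (velocity F s x) = 0
  rw [h2, h1, sub_self]

/-- The tangential part of v is orthogonal to the normal part of w, so only one of the two
projections has to be expanded. -/
lemma pairing_normalPart {G : (κ → ℝ) → Matrix κ κ ℝ} {F : (ι → ℝ) → κ → ℝ} {x : ι → ℝ}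
    (hs : (G (F x)).IsSymm) (hg : (pullback G F x).det ≠ 0) (v w : κ → ℝ) :
    pairing (G (F x)) (normalPart G F x v) (normalPart G F x w)
      = pairing (G (F x)) v w - ∑ k, ∑ l, (pullback G F x)⁻¹ k l
          * pairing (G (F x)) v (velocity F k x) * pairing (G (F x)) w (velocity F l x) := by
  have h1 : pairing (G (F x)) (normalPart G F x v) (normalPart G F x w)
      = pairing (G (F x)) v (normalPart G F x w) := by
    conv_lhs => rw [normalPart, pairing_sub_left]
    simp only [pairing_sum_left, pairing_smul_left]
    simp only [pairing_comm hs (velocity F _ x), pairing_normalPart_velocity hs hg]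
    simp
  rw [h1, normalPart, pairing_sub_right]
  simp only [pairing_sum_right, pairing_smul_right]
  congr 1
  exact Finset.sum_congr rfl fun k _ => Finset.sum_congr rfl fun l _ => by ring

/-- The Gauss equation for a nondegenerate immersion into a pseudo-Riemannian manifold. -/
theorem gauss_equation {G : (κ → ℝ) → Matrix κ κ ℝ} {F : (ι → ℝ) → κ → ℝ} {x : ι → ℝ}
    (hG : IsMetricAt G (F x)) (hF : ∀ a, ContDiffAt ℝ 3 (fun s => F s a) x)
    (hg : IsMetricAt (pullback G F) x) (i j k l : ι) :
    ∑ a, ∑ b, ∑ c, ∑ e, riem G a b c e (F x) * velocity F i x a * velocity F j x b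
        * velocity F k x c * velocity F l x e
      = riem (pullback G F) i j k l x
        - pairing (G (F x)) (normalPart G F x (alongDeriv G F i (velocity F k) x))
            (normalPart G F x (alongDeriv G F j (velocity F l) x))
        + pairing (G (F x)) (normalPart G F x (alongDeriv G F i (velocity F l) x))
            (normalPart G F x (alongDeriv G F j (velocity F k) x)) := by
  have hs : (G (F x)).IsSymm := hG.symm.self_of_nhds
  have hF2 : ∀ a, ContDiffAt ℝ 2 (fun s => F s a) x := fun a => (hF a).of_le (by norm_num)
  -- The derivative terms of the two curvatures are identical. By Koszul's formula the quadratic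
  -- terms of the intrinsic curvature are exactly the tangential corrections in
  -- `pairing_normalPart`.
  rw [sum_riem_velocity_eq hG hF, riem_eq hg, pairing_christoffel hg,
    pairing_comm hg.symm.self_of_nhds (fun m => christoffel (pullback G F) m j k x),
    pairing_christoffel hg, pairing_normalPart hs hg.det, pairing_normalPart hs hg.det,
    pairing_comm hs (alongDeriv G F j (velocity F k) x)]
  simp only [pairing_alongDeriv_velocity hG hF2]
  ring

end Gauss

/-! ### Vanishing of curvature components for para-Kähler metrics -/

section ParaKahler

variable {κ : Type} [Fintype κ] [DecidableEq κ]

/-- `G` is a para-Kähler metric near `p`, in coordinates adapted to its two null foliations: `s`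
tells to which of the two foliations a coordinate belongs. -/
structure IsParaKahlerAt (s : κ → Bool) (G : (κ → ℝ) → Matrix κ κ ℝ) (p : κ → ℝ) : Prop where
  metric : IsMetricAt G p
  null : ∀ᶠ q in 𝓝 p, ∀ a b, s a = s b → G q a b = 0
  inv_null : ∀ a b, s a = s b → (G p)⁻¹ a b = 0
  closed : ∀ᶠ q in 𝓝 p, ∀ a b e, s a = s b →
    pd a (fun r => G r b e) q = pd b (fun r => G r a e) q

namespace IsParaKahlerAt

variable {s : κ → Bool} {G : (κ → ℝ) → Matrix κ κ ℝ} {p : κ → ℝ}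

/-- Nullity removes the derivative of G a b, and closedness makes the other two equal. The equality
holds near p because `riem_eq` differentiates it. -/
lemma christoffelLow_eventuallyEq (h : IsParaKahlerAt s G p) {a b : κ} (hab : s a = s b) (e : κ) :
    christoffelLow G a b e =ᶠ[𝓝 p] pd a fun r => G r b e := by
  filter_upwards [h.null.eventually_nhds, h.closed] with q h1 h2
  have h3 : pd e (fun r => G r a b) q = 0 := by
    rw [pd_congr (g := fun _ => 0) (h1.mono fun r hr => hr a b hab), pd_const]
  rw [christoffelLow, h3, h2 a b e hab]; ring

/-- There are only two types, so e shares the type of a or of b. In either case one derivative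
vanishes by nullity and the other two cancel by closedness. -/
lemma christoffelLow_eventuallyEq_zero (h : IsParaKahlerAt s G p) {a b : κ} (hab : s a ≠ s b)
    (e : κ) : christoffelLow G a b e =ᶠ[𝓝 p] fun _ => 0 := by
  filter_upwards [h.null.eventually_nhds, h.closed, h.metric.eventually] with q h1 h2 h3
  have hz : ∀ i a b, s a = s b → pd i (fun r => G r a b) q = 0 := fun i a b hab => by
    rw [pd_congr (g := fun _ => 0) (h1.mono fun r hr => hr a b hab), pd_const]
  by_cases he : s a = s e
  · rw [christoffelLow, hz b a e he, h3.pd_symm a b e, h2 a e b he]; ring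
  · have he' : s b = s e := by
      revert hab he; cases s a <;> cases s b <;> cases s e <;> simp
    rw [christoffelLow, hz a b e he', h3.pd_symm b a e, h2 b e a he', h3.pd_symm e b a]; ring

lemma christoffelLow_eventuallyEq_zero_of_eq (h : IsParaKahlerAt s G p) {a b e : κ}
    (hbe : s b = s e) : christoffelLow G a b e =ᶠ[𝓝 p] fun _ => 0 := by
  by_cases hab : s a = s b
  · refine (h.christoffelLow_eventuallyEq hab e).trans ?_
    have : (fun r => G r b e) =ᶠ[𝓝 p] fun _ => 0 := h.null.mono fun q hq => hq b e hbe
    exact (pd_eventuallyEq a this).trans (Eventually.of_forall fun q => pd_const a 0 q)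
  · exact h.christoffelLow_eventuallyEq_zero hab e

lemma christoffel_eq_zero (h : IsParaKahlerAt s G p) {a b : κ} (hab : s a ≠ s b) (k : κ) :
    christoffel G k a b p = 0 := by
  rw [christoffel_eq]
  exact Finset.sum_eq_zero fun l _ => by
    rw [(h.christoffelLow_eventuallyEq_zero hab l).self_of_nhds, mul_zero]

/-- Each null foliation is parallel: the lowered symbol requires l of type opposite to b, and the
inverse metric then requires k of the type of b. -/
lemma christoffel_eq_zero_of_ne (h : IsParaKahlerAt s G p) {a b k : κ} (hk : s k ≠ s b) :
    christoffel G k a b p = 0 := by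
  rw [christoffel_eq]
  refine Finset.sum_eq_zero fun l _ => ?_
  by_cases hl : s b = s l
  · rw [(h.christoffelLow_eventuallyEq_zero_of_eq hl).self_of_nhds, mul_zero]
  · have hkl : s k = s l := by revert hk hl; cases s k <;> cases s b <;> cases s l <;> simp
    rw [h.inv_null k l hkl, zero_mul]

lemma pairing_christoffel_eq_zero (h : IsParaKahlerAt s G p) {a b c e : κ} (hce : s c = s e) :
    pairing (G p) (fun m => christoffel G m a c p) (fun m => christoffel G m b e p) = 0 := by
  refine Finset.sum_eq_zero fun m _ => Finset.sum_eq_zero fun n _ => ?_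
  by_cases hm : s m = s c
  · by_cases hn : s n = s e
    · rw [h.null.self_of_nhds m n (by rw [hm, hn, hce]), zero_mul, zero_mul]
    · simp only [h.christoffel_eq_zero_of_ne hn, mul_zero]
  · simp only [h.christoffel_eq_zero_of_ne hm, mul_zero, zero_mul]

/-- The curvature operator preserves each of the parallel distributions, and these are totally null.
-/
lemma riem_eq_zero_right (h : IsParaKahlerAt s G p) {c e : κ} (a b : κ) (hce : s c = s e) :
    riem G a b c e p = 0 := by
  rw [riem_eq h.metric, h.pairing_christoffel_eq_zero hce, h.pairing_christoffel_eq_zero hce,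
    pd_congr (h.christoffelLow_eventuallyEq_zero_of_eq hce),
    pd_congr (h.christoffelLow_eventuallyEq_zero_of_eq hce)]
  simp

/-- For c and e of different types, antisymmetry in the last pair lets c have the type of a and b.
The derivative terms are then ∂_b∂_a G_{ce} - ∂_a∂_b G_{ce} = 0, and each quadratic term contains a
mixed Christoffel symbol. -/
lemma riem_eq_zero_left (h : IsParaKahlerAt s G p) {a b : κ} (c e : κ) (hab : s a = s b) :
    riem G a b c e p = 0 := by
  by_cases hce : s c = s e
  · exact h.riem_eq_zero_right a b hce
  · have key : ∀ c e, s a = s c → s c ≠ s e → riem G a b c e p = 0 := by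
      intro c e hac hce
      have h1 : s b = s c := hab ▸ hac
      have h2 : s b ≠ s e := h1 ▸ hce
      have h3 : s a ≠ s e := hac ▸ hce
      rw [riem_eq h.metric, pd_congr (h.christoffelLow_eventuallyEq hac e),
        pd_congr (h.christoffelLow_eventuallyEq h1 e), pd_comm (h.metric.smooth c e)]
      simp [pairing, h.christoffel_eq_zero h2, h.christoffel_eq_zero h3]
    by_cases hac : s a = s c
    · exact key c e hac hce
    · rw [riem_swap_right h.metric, key e c ?_ (Ne.symm hce), neg_zero]
      revert hac hce; cases s a <;> cases s c <;> cases s e <;> simp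

end IsParaKahlerAt

end ParaKahler

/-! ### The Kim–McCann metric is para-Kähler -/

section KimMcCannMetric

variable {d : ℕ}

/-- The cost as a function on the product. -/
def costFun (c : (Fin d → ℝ) → (Fin d → ℝ) → ℝ) (r : Fin d ⊕ Fin d → ℝ) : ℝ :=
  c (r ∘ Sum.inl) (r ∘ Sum.inr)

variable {c : (Fin d → ℝ) → (Fin d → ℝ) → ℝ} {p : Fin d ⊕ Fin d → ℝ}

lemma mixedHess_apply (c : (Fin d → ℝ) → (Fin d → ℝ) → ℝ) (p : Fin d ⊕ Fin d → ℝ) (i j : Fin d) :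
    mixedHess c p i j = pd (Sum.inl i) (pd (Sum.inr j) (costFun c)) p := rfl

lemma contDiffAt_mixedHess (hc : ContDiffAt ℝ 4 (costFun c) p) (i j : Fin d) :
    ContDiffAt ℝ 2 (fun q => mixedHess c q i j) p :=
  contDiffAt_pd (contDiffAt_pd (m := 3) hc (by norm_num)) (by norm_num)

lemma kmMetric_isSymm (c : (Fin d → ℝ) → (Fin d → ℝ) → ℝ) (p : Fin d ⊕ Fin d → ℝ) :
    (kmMetric c p).IsSymm := by
  rw [Matrix.IsSymm, kmMetric, Matrix.fromBlocks_transpose]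
  simp

lemma kmMetric_mul (h : IsUnit (mixedHess c p).det) :
    kmMetric c p * Matrix.fromBlocks 0 ((-2 : ℝ) • ((mixedHess c p)⁻¹).transpose)
      ((-2 : ℝ) • (mixedHess c p)⁻¹) 0 = 1 := by
  have h1 : (mixedHess c p).transpose * ((mixedHess c p)⁻¹).transpose = 1 := by
    rw [← Matrix.transpose_mul, Matrix.nonsing_inv_mul _ h, Matrix.transpose_one]
  rw [kmMetric, Matrix.fromBlocks_multiply]
  simp [h1, Matrix.mul_nonsing_inv _ h, smul_smul]

lemma kmMetric_inv (h : IsUnit (mixedHess c p).det) :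
    (kmMetric c p)⁻¹ = Matrix.fromBlocks 0 ((-2 : ℝ) • ((mixedHess c p)⁻¹).transpose)
      ((-2 : ℝ) • (mixedHess c p)⁻¹) 0 :=
  Matrix.inv_eq_right_inv (kmMetric_mul h)

lemma isMetricAt_kmMetric (hc : ContDiffAt ℝ 4 (costFun c) p)
    (h : IsUnit (mixedHess c p).det) : IsMetricAt (kmMetric c) p where
  smooth := by
    rintro (i | i) (j | j)
    · exact contDiffAt_const
    · exact contDiffAt_const.mul (contDiffAt_mixedHess hc i j)
    · exact contDiffAt_const.mul (contDiffAt_mixedHess hc j i)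
    · exact contDiffAt_const
  symm := Eventually.of_forall fun q => kmMetric_isSymm c q
  det := (Matrix.isUnit_det_of_right_inverse (kmMetric_mul h)).ne_zero

/-- Both sides are the same third derivative of -c/2 up to the order of differentiation, or are both
zero. -/
lemma pd_kmMetric_comm (hc : ContDiffAt ℝ 4 (costFun c) p) {a b : Fin d ⊕ Fin d}
    (e : Fin d ⊕ Fin d) (hab : a.isLeft = b.isLeft) :
    pd a (fun r => kmMetric c r b e) p = pd b (fun r => kmMetric c r a e) p := by
  have h3 : ∀ a, ContDiffAt ℝ 3 (pd a (costFun c)) p := fun a => contDiffAt_pd hc (by norm_num)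
  have h3' : ∀ a, ContDiffAt ℝ 2 (pd a (costFun c)) p := fun a => (h3 a).of_le (by norm_num)
  have h1 : ∀ i j, DifferentiableAt ℝ (fun q => mixedHess c q i j) p := fun i j =>
    (contDiffAt_mixedHess hc i j).differentiableAt (by norm_num)
  have hlr : ∀ i j, (fun r => kmMetric c r (Sum.inl i) (Sum.inr j))
      = fun r => -(1 / 2) * mixedHess c r i j := fun _ _ => rfl
  have hrl : ∀ i j, (fun r => kmMetric c r (Sum.inr j) (Sum.inl i))
      = fun r => -(1 / 2) * mixedHess c r i j := fun _ _ => rfl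
  have hll : ∀ i j, (fun r => kmMetric c r (Sum.inl i) (Sum.inl j)) = fun _ => 0 := fun _ _ => rfl
  have hrr : ∀ i j, (fun r => kmMetric c r (Sum.inr i) (Sum.inr j)) = fun _ => 0 := fun _ _ => rfl
  rcases a with i | i <;> rcases b with k | k <;> simp at hab
  · rcases e with l | l
    · rw [hll, hll, pd_const, pd_const]
    · rw [hlr, hlr, pd_const_mul _ (h1 _ _), pd_const_mul _ (h1 _ _)]
      congr 1
      exact pd_comm (h3' _)
  · rcases e with l | l
    · rw [hrl, hrl, pd_const_mul _ (h1 _ _), pd_const_mul _ (h1 _ _)]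
      congr 1
      have e1 : pd (Sum.inr i) (pd (Sum.inr k) (costFun c))
          =ᶠ[𝓝 p] pd (Sum.inr k) (pd (Sum.inr i) (costFun c)) :=
        (hc.eventually (by simp)).mono fun q hq => pd_comm (hq.of_le (by norm_num))
      calc pd (Sum.inr i) (pd (Sum.inl l) (pd (Sum.inr k) (costFun c))) p
          = pd (Sum.inl l) (pd (Sum.inr i) (pd (Sum.inr k) (costFun c))) p := pd_comm (h3' _)
        _ = pd (Sum.inl l) (pd (Sum.inr k) (pd (Sum.inr i) (costFun c))) p := pd_congr e1
        _ = pd (Sum.inr k) (pd (Sum.inl l) (pd (Sum.inr i) (costFun c))) p := pd_comm (h3' _)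
    · rw [hrr, hrr, pd_const, pd_const]

lemma isParaKahlerAt_kmMetric (hc : ContDiffAt ℝ 4 (costFun c) p)
    (h : IsUnit (mixedHess c p).det) : IsParaKahlerAt Sum.isLeft (kmMetric c) p where
  metric := isMetricAt_kmMetric hc h
  null := Eventually.of_forall fun q => by
    rintro (i | i) (j | j) hab <;> first | rfl | simp at hab
  inv_null := by
    rw [kmMetric_inv h]
    rintro (i | i) (j | j) hab <;> first | rfl | simp at hab
  closed := (hc.eventually (by simp)).mono fun q hq a b e hab => pd_kmMetric_comm hq e hab

end KimMcCannMetric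

/-! ### Geometry of the graph and the first-order conditions -/

section Graph

variable {d : ℕ} {c : (Fin d → ℝ) → (Fin d → ℝ) → ℝ} {φ ψ : (Fin d → ℝ) → ℝ}
  {y : (Fin d → ℝ) → Fin d → ℝ} {x : Fin d → ℝ}

lemma velocity_emb (y : (Fin d → ℝ) → Fin d → ℝ) (i : Fin d) (x : Fin d → ℝ) :
    velocity (emb y) i x = tanField y i (emb y x) := by
  ext (a | a)
  · exact pd_apply i a x
  · rfl

lemma pullback_emb (c : (Fin d → ℝ) → (Fin d → ℝ) → ℝ) (y : (Fin d → ℝ) → Fin d → ℝ) :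
    pullback (kmMetric c) (emb y) = indMetric c y := by
  ext x i j
  simp only [pullback, indMetric, velocity_emb]

lemma contDiffAt_emb {n : WithTop ℕ∞} (hy : ContDiffAt ℝ n y x) (a : Fin d ⊕ Fin d) :
    ContDiffAt ℝ n (fun s => emb y s a) x := by
  rcases a with a | a
  · exact contDiffAt_pi.1 contDiffAt_id a
  · exact contDiffAt_pi.1 hy a

/-- Since tᵢ is tangent to the graph, the chain rule turns the ambient derivative of the extended
field into a derivative along x ↦ (x, y(x)). -/
lemma covDeriv_tanField (G : (Fin d ⊕ Fin d → ℝ) → Matrix (Fin d ⊕ Fin d) (Fin d ⊕ Fin d) ℝ)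
    (hy : ContDiffAt ℝ 2 y x) (i j : Fin d) :
    covDeriv G (tanField y i) (tanField y j) (emb y x)
      = alongDeriv G (emb y) i (velocity (emb y) j) x := by
  have hF : ∀ a, DifferentiableAt ℝ (fun s => emb y s a) x := fun a =>
    (contDiffAt_emb hy a).differentiableAt (by norm_num)
  have hT : ∀ k, DifferentiableAt ℝ (fun q => tanField y j q k) (emb y x) := by
    rintro (k | k)
    · exact differentiableAt_const _
    · have h1 : DifferentiableAt ℝ (dy y j k) x :=
        (contDiffAt_pd (m := 1) (contDiffAt_pi.1 hy k) (by norm_num)).differentiableAt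
          (by norm_num)
      have h2 : DifferentiableAt ℝ (fun q : Fin d ⊕ Fin d → ℝ => q ∘ Sum.inl) (emb y x) :=
        differentiableAt_pi.2 fun a => differentiableAt_apply _ _
      exact DifferentiableAt.comp (emb y x) (g := dy y j k) h1 h2
  ext k
  have h := pd_comp (i := i) (hT k) hF
  simp only [alongDeriv, covDeriv, connMat, velocity_emb, Finset.sum_mul, h]
  congr 1
  · refine Finset.sum_congr rfl fun a _ => ?_
    rw [mul_comm, ← velocity_emb]; rfl
  · rw [Finset.sum_comm]

lemma secondFF_eq (c : (Fin d → ℝ) → (Fin d → ℝ) → ℝ) (hy : ContDiffAt ℝ 2 y x) (i j : Fin d) :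
    secondFF c y (tanField y i) (tanField y j) x
      = normalPart (kmMetric c) (emb y) x
          (alongDeriv (kmMetric c) (emb y) i (velocity (emb y) j) x) := by
  simp only [secondFF, tanProj, normalPart, covDeriv_tanField _ hy, pullback_emb, velocity_emb]

lemma contDiffAt_costFun {n : WithTop ℕ∞}
    (hc : ContDiffAt ℝ n (fun p : (Fin d → ℝ) × (Fin d → ℝ) => c p.1 p.2) (x, y x)) :
    ContDiffAt ℝ n (costFun c) (emb y x) := by
  have h2 : ContDiffAt ℝ n
      (fun r : Fin d ⊕ Fin d → ℝ => ((r ∘ Sum.inl, r ∘ Sum.inr) : (Fin d → ℝ) × (Fin d → ℝ)))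
      (emb y x) :=
    (contDiffAt_pi.2 fun a => contDiff_apply _ _ _ |>.contDiffAt).prodMk
      (contDiffAt_pi.2 fun a => contDiff_apply _ _ _ |>.contDiffAt)
  exact ContDiffAt.comp (emb y x) (f := fun r : Fin d ⊕ Fin d → ℝ =>
    ((r ∘ Sum.inl, r ∘ Sum.inr) : (Fin d → ℝ) × (Fin d → ℝ)))
    (g := fun p : (Fin d → ℝ) × (Fin d → ℝ) => c p.1 p.2) hc h2

lemma contDiffAt_elim_left {n : WithTop ℕ∞} (q z : Fin d → ℝ) :
    ContDiffAt ℝ n (fun s : Fin d → ℝ => (Sum.elim s z : Fin d ⊕ Fin d → ℝ)) q := by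
  refine contDiffAt_pi.2 ?_
  rintro (a | a)
  · exact contDiffAt_pi.1 contDiffAt_id a
  · exact contDiffAt_const

lemma contDiffAt_elim_right {n : WithTop ℕ∞} (q z : Fin d → ℝ) :
    ContDiffAt ℝ n (fun s : Fin d → ℝ => (Sum.elim q s : Fin d ⊕ Fin d → ℝ)) z := by
  refine contDiffAt_pi.2 ?_
  rintro (a | a)
  · exact contDiffAt_const
  · exact contDiffAt_pi.1 contDiffAt_id a

lemma pd_comp_elim_left {f : (Fin d ⊕ Fin d → ℝ) → ℝ} {q z : Fin d → ℝ}
    (hf : DifferentiableAt ℝ f (Sum.elim q z)) (j : Fin d) :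
    pd j (fun s => f (Sum.elim s z)) q = pd (Sum.inl j) f (Sum.elim q z) := by
  rw [pd_comp (F := fun s => Sum.elim s z) hf
    (fun a => (contDiffAt_pi.1 (contDiffAt_elim_left (n := 1) q z) a).differentiableAt
      (by norm_num))]
  simp [pd_apply, Pi.single_apply]

lemma pd_comp_elim_right {f : (Fin d ⊕ Fin d → ℝ) → ℝ} {q z : Fin d → ℝ}
    (hf : DifferentiableAt ℝ f (Sum.elim q z)) (j : Fin d) :
    pd j (fun s => f (Sum.elim q s)) z = pd (Sum.inr j) f (Sum.elim q z) := by
  rw [pd_comp (F := fun s => Sum.elim q s) hf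
    (fun a => (contDiffAt_pi.1 (contDiffAt_elim_right (n := 1) q z) a).differentiableAt
      (by norm_num))]
  simp [pd_apply, Pi.single_apply]

lemma pd_comp_emb {f : (Fin d ⊕ Fin d → ℝ) → ℝ} (hf : DifferentiableAt ℝ f (emb y x))
    (hy : DifferentiableAt ℝ y x) (i : Fin d) :
    pd i (fun s => f (emb y s)) x
      = pd (Sum.inl i) f (emb y x) + ∑ k, pd (Sum.inr k) f (emb y x) * dy y i k x := by
  have hF : ∀ a, DifferentiableAt ℝ (fun s => emb y s a) x := by
    rintro (a | a)
    · exact differentiableAt_pi.1 differentiableAt_id a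
    · exact differentiableAt_pi.1 hy a
  rw [pd_comp hf hF]
  simp [emb, pd_apply, Pi.single_apply, dy]

lemma pd_cDiv_left {q z : Fin d → ℝ} (hc : ContDiffAt ℝ 1 (costFun c) (Sum.elim q z))
    (hφ : ContDiffAt ℝ 1 φ q) (j : Fin d) :
    pd j (fun s => cDiv c φ ψ s z) q = pd (Sum.inl j) (costFun c) (Sum.elim q z) - pd j φ q := by
  have hc1 : DifferentiableAt ℝ (costFun c) (Sum.elim q z) := hc.differentiableAt (by norm_num)
  have hd : DifferentiableAt ℝ (fun s => costFun c (Sum.elim s z)) q :=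
    DifferentiableAt.comp q (f := fun s : Fin d → ℝ => (Sum.elim s z : Fin d ⊕ Fin d → ℝ)) hc1
      ((contDiffAt_elim_left (n := 1) q z).differentiableAt (by norm_num))
  have hφ1 : DifferentiableAt ℝ φ q := hφ.differentiableAt (by norm_num)
  have h0 : (fun s => cDiv c φ ψ s z) = fun s => costFun c (Sum.elim s z) - φ s - ψ z := rfl
  rw [h0, pd_sub (hd.fun_sub hφ1) (differentiableAt_const _), pd_sub hd hφ1,
    pd_comp_elim_left hc1, pd_const, sub_zero]

lemma pd_cDiv_right {q z : Fin d → ℝ} (hc : ContDiffAt ℝ 1 (costFun c) (Sum.elim q z))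
    (hψ : ContDiffAt ℝ 1 ψ z) (j : Fin d) :
    pd j (fun s => cDiv c φ ψ q s) z = pd (Sum.inr j) (costFun c) (Sum.elim q z) - pd j ψ z := by
  have hc1 : DifferentiableAt ℝ (costFun c) (Sum.elim q z) := hc.differentiableAt (by norm_num)
  have hd : DifferentiableAt ℝ (fun s => costFun c (Sum.elim q s)) z :=
    DifferentiableAt.comp z (f := fun s : Fin d → ℝ => (Sum.elim q s : Fin d ⊕ Fin d → ℝ)) hc1
      ((contDiffAt_elim_right (n := 1) q z).differentiableAt (by norm_num))
  have hψ1 : DifferentiableAt ℝ ψ z := hψ.differentiableAt (by norm_num)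
  have h0 : (fun s => cDiv c φ ψ q s) = fun s => costFun c (Sum.elim q s) - φ q - ψ s := rfl
  rw [h0, pd_sub (hd.fun_sub (differentiableAt_const _)) hψ1,
    pd_sub hd (differentiableAt_const _), pd_comp_elim_right hc1, pd_const, sub_zero]

lemma uHessX_apply (hc : ContDiffAt ℝ 4 (costFun c) (emb y x)) (hφ : ContDiffAt ℝ 2 φ x)
    (i j : Fin d) :
    uHessX c φ ψ y x i j
      = pd (Sum.inl i) (pd (Sum.inl j) (costFun c)) (emb y x) - pd i (pd j φ) x := by
  have hcont : ContinuousAt (fun s : Fin d → ℝ => (Sum.elim s (y x) : Fin d ⊕ Fin d → ℝ)) x :=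
    (contDiffAt_elim_left (n := 0) x (y x)).continuousAt
  have hev : pd j (fun s => cDiv c φ ψ s (y x)) =ᶠ[𝓝 x] fun q =>
      pd (Sum.inl j) (costFun c) (Sum.elim q (y x)) - pd j φ q := by
    filter_upwards [hcont.eventually (hc.eventually (by simp)), hφ.eventually (by simp)]
      with q h1 h2
    exact pd_cDiv_left (h1.of_le (by norm_num)) (h2.of_le (by norm_num)) j
  have h1 : DifferentiableAt ℝ (pd (Sum.inl j) (costFun c)) (Sum.elim x (y x)) :=
    (contDiffAt_pd (m := 1) (n := 4) hc (by norm_num)).differentiableAt (by norm_num)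
  have h2 : DifferentiableAt ℝ (fun s => pd (Sum.inl j) (costFun c) (Sum.elim s (y x))) x :=
    DifferentiableAt.comp x (f := fun s : Fin d → ℝ => (Sum.elim s (y x) : Fin d ⊕ Fin d → ℝ)) h1
      ((contDiffAt_elim_left (n := 1) x (y x)).differentiableAt (by norm_num))
  have h3 : DifferentiableAt ℝ (pd j φ) x :=
    (contDiffAt_pd (m := 1) hφ (by norm_num)).differentiableAt (by norm_num)
  change pd i (pd j fun s => cDiv c φ ψ s (y x)) x = _
  rw [pd_congr hev, pd_sub h2 h3, pd_comp_elim_left h1]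
  rfl

lemma uHessY_apply (hc : ContDiffAt ℝ 4 (costFun c) (emb y x)) (hψ : ContDiffAt ℝ 2 ψ (y x))
    (i j : Fin d) :
    uHessY c φ ψ y x i j
      = pd (Sum.inr i) (pd (Sum.inr j) (costFun c)) (emb y x) - pd i (pd j ψ) (y x) := by
  have hcont : ContinuousAt (fun s : Fin d → ℝ => (Sum.elim x s : Fin d ⊕ Fin d → ℝ)) (y x) :=
    (contDiffAt_elim_right (n := 0) x (y x)).continuousAt
  have hev : pd j (fun s => cDiv c φ ψ x s) =ᶠ[𝓝 (y x)] fun q =>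
      pd (Sum.inr j) (costFun c) (Sum.elim x q) - pd j ψ q := by
    filter_upwards [hcont.eventually (hc.eventually (by simp)), hψ.eventually (by simp)]
      with q h1 h2
    exact pd_cDiv_right (h1.of_le (by norm_num)) (h2.of_le (by norm_num)) j
  have h1 : DifferentiableAt ℝ (pd (Sum.inr j) (costFun c)) (Sum.elim x (y x)) :=
    (contDiffAt_pd (m := 1) (n := 4) hc (by norm_num)).differentiableAt (by norm_num)
  have h2 : DifferentiableAt ℝ (fun s => pd (Sum.inr j) (costFun c) (Sum.elim x s)) (y x) :=
    DifferentiableAt.comp (y x)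
      (f := fun s : Fin d → ℝ => (Sum.elim x s : Fin d ⊕ Fin d → ℝ)) h1
      ((contDiffAt_elim_right (n := 1) x (y x)).differentiableAt (by norm_num))
  have h3 : DifferentiableAt ℝ (pd j ψ) (y x) :=
    (contDiffAt_pd (m := 1) hψ (by norm_num)).differentiableAt (by norm_num)
  change pd i (pd j fun s => cDiv c φ ψ x s) (y x) = _
  rw [pd_congr hev, pd_sub h2 h3, pd_comp_elim_right h1]
  rfl

lemma uHessX_isSymm (hc : ContDiffAt ℝ 4 (costFun c) (emb y x)) (hφ : ContDiffAt ℝ 2 φ x) :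
    (uHessX c φ ψ y x).IsSymm := by
  ext i j
  rw [Matrix.transpose_apply, uHessX_apply hc hφ, uHessX_apply hc hφ, pd_comm hφ,
    pd_comm (hc.of_le (by norm_num))]

/-- The Jacobian matrix `∂ᵢ y^{j̄}`. -/
noncomputable def jac (y : (Fin d → ℝ) → Fin d → ℝ) (x : Fin d → ℝ) :
    Matrix (Fin d) (Fin d) ℝ :=
  Matrix.of fun i j => dy y i j x

/-- Differentiating c_j(x, y(x)) = φ_j(x) gives c_{ij} + ∂ᵢy^k̄ c_{jk̄} = φ_{ij}. -/
lemma uHessX_eq (hc : ContDiffAt ℝ 4 (costFun c) (emb y x)) (hφ : ContDiffAt ℝ 2 φ x)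
    (hy : DifferentiableAt ℝ y x)
    (h : ∀ᶠ q in 𝓝 x, ∀ j, pd (Sum.inl j) (costFun c) (emb y q) = pd j φ q) :
    uHessX c φ ψ y x = -(jac y x * (mixedHess c (emb y x)).transpose) := by
  ext i j
  have h1 : DifferentiableAt ℝ (pd (Sum.inl j) (costFun c)) (emb y x) :=
    (contDiffAt_pd (m := 1) hc (by norm_num)).differentiableAt (by norm_num)
  have h2 : pd i (pd j φ) x = pd i (fun s => pd (Sum.inl j) (costFun c) (emb y s)) x :=
    (pd_congr (h.mono fun q hq => hq j)).symm
  have h3 : ∀ k, pd (Sum.inr k) (pd (Sum.inl j) (costFun c)) (emb y x)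
      = mixedHess c (emb y x) j k := fun k => pd_comm (hc.of_le (by norm_num))
  rw [uHessX_apply hc hφ, h2, pd_comp_emb h1 hy]
  simp only [h3, Matrix.neg_apply, Matrix.mul_apply, Matrix.transpose_apply, jac, Matrix.of_apply,
    mul_comm (dy y i _ x)]
  ring

/-- Differentiating c_j̄(x, y(x)) = ψ_j̄(y(x)) gives c_{ij̄} + ∂ᵢy^k̄ (c_{k̄j̄} - ψ_{k̄j̄}) = 0. -/
lemma mixedHess_eq (hc : ContDiffAt ℝ 4 (costFun c) (emb y x)) (hψ : ContDiffAt ℝ 2 ψ (y x))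
    (hy : DifferentiableAt ℝ y x)
    (h : ∀ᶠ q in 𝓝 x, ∀ j, pd (Sum.inr j) (costFun c) (emb y q) = pd j ψ (y q)) :
    mixedHess c (emb y x) = -(jac y x * uHessY c φ ψ y x) := by
  ext i j
  have h1 : DifferentiableAt ℝ (pd (Sum.inr j) (costFun c)) (emb y x) :=
    (contDiffAt_pd (m := 1) hc (by norm_num)).differentiableAt (by norm_num)
  have h4 : DifferentiableAt ℝ (pd j ψ) (y x) :=
    (contDiffAt_pd (m := 1) hψ (by norm_num)).differentiableAt (by norm_num)
  have h2 : pd i (fun s => pd j ψ (y s)) x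
      = pd i (fun s => pd (Sum.inr j) (costFun c) (emb y s)) x :=
    (pd_congr (h.mono fun q hq => hq j)).symm
  rw [pd_comp_emb h1 hy, pd_comp h4 (differentiableAt_pi.1 hy)] at h2
  rw [mixedHess_apply]
  simp only [Matrix.neg_apply, Matrix.mul_apply, jac, Matrix.of_apply, uHessY_apply hc hψ,
    sub_mul, Finset.sum_sub_distrib, mul_comm (dy y i _ x)]
  have h5 : ∑ a, pd a (pd j ψ) (y x) * pd i (fun s => y s a) x
      = ∑ k, pd k (pd j ψ) (y x) * dy y i k x := rfl
  rw [h5] at h2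
  linarith

lemma first_order_left {X Y : Set (Fin d → ℝ)} (hX : IsOpen X) (hx : x ∈ X)
    (hyY : Set.MapsTo y X Y) (hu : ∀ x ∈ X, ∀ z ∈ Y, 0 ≤ cDiv c φ ψ x z)
    (h0 : cDiv c φ ψ x (y x) = 0) (hc : ContDiffAt ℝ 1 (costFun c) (emb y x))
    (hφ : ContDiffAt ℝ 1 φ x) (j : Fin d) :
    pd (Sum.inl j) (costFun c) (emb y x) = pd j φ x := by
  have hmin : IsLocalMin (fun s => cDiv c φ ψ s (y x)) x := by
    filter_upwards [hX.mem_nhds hx] with s hs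
    rw [h0]; exact hu s hs _ (hyY hx)
  have h1 : pd j (fun s => cDiv c φ ψ s (y x)) x = 0 := by
    rw [pd, hmin.fderiv_eq_zero]; rfl
  rw [pd_cDiv_left hc hφ] at h1
  exact sub_eq_zero.1 h1

lemma first_order_right {X Y : Set (Fin d → ℝ)} (hY : IsOpen Y) (hx : x ∈ X)
    (hyY : Set.MapsTo y X Y) (hu : ∀ x ∈ X, ∀ z ∈ Y, 0 ≤ cDiv c φ ψ x z)
    (h0 : cDiv c φ ψ x (y x) = 0) (hc : ContDiffAt ℝ 1 (costFun c) (emb y x))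
    (hψ : ContDiffAt ℝ 1 ψ (y x)) (j : Fin d) :
    pd (Sum.inr j) (costFun c) (emb y x) = pd j ψ (y x) := by
  have hmin : IsLocalMin (fun s => cDiv c φ ψ x s) (y x) := by
    filter_upwards [hY.mem_nhds (hyY hx)] with s hs
    rw [h0]; exact hu x hx s hs
  have h1 : pd j (fun s => cDiv c φ ψ x s) (y x) = 0 := by
    rw [pd, hmin.fderiv_eq_zero]; rfl
  rw [pd_cDiv_right hc hψ] at h1
  exact sub_eq_zero.1 h1

lemma pairing_kmMetric (c : (Fin d → ℝ) → (Fin d → ℝ) → ℝ) (p v w : Fin d ⊕ Fin d → ℝ) :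
    pairing (kmMetric c p) v w
      = -(1 / 2) * ((v ∘ Sum.inl) ⬝ᵥ (mixedHess c p).mulVec (w ∘ Sum.inr)
        + (w ∘ Sum.inl) ⬝ᵥ (mixedHess c p).mulVec (v ∘ Sum.inr)) := by
  simp only [pairing, kmMetric, Fintype.sum_sum_type, Matrix.fromBlocks_apply₁₁,
    Matrix.fromBlocks_apply₁₂, Matrix.fromBlocks_apply₂₁, Matrix.fromBlocks_apply₂₂,
    Matrix.zero_apply, zero_mul, Finset.sum_const_zero, zero_add, add_zero, Matrix.smul_apply,
    Matrix.transpose_apply, smul_eq_mul, dotProduct, Matrix.mulVec, Function.comp_apply, mul_add,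
    Finset.mul_sum]
  congr 1
  · exact Finset.sum_congr rfl fun _ _ => Finset.sum_congr rfl fun _ _ => by ring
  · rw [Finset.sum_comm]
    exact Finset.sum_congr rfl fun _ _ => Finset.sum_congr rfl fun _ _ => by ring

/-- Reduces orthogonality to Σ to one linear relation: (ξ, η) is normal exactly when Cη = Uξ. For
symmetric U, tangent vectors satisfy Cη = -Uξ, which is why K exchanges the two. -/
lemma pairing_tanField {U : Matrix (Fin d) (Fin d) ℝ}
    (hU : U = -(jac y x * (mixedHess c (emb y x)).transpose)) (v : Fin d ⊕ Fin d → ℝ)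
    (l : Fin d) :
    pairing (kmMetric c (emb y x)) v (tanField y l (emb y x))
      = 1 / 2 * (U.mulVec (v ∘ Sum.inl) l
        - (mixedHess c (emb y x)).mulVec (v ∘ Sum.inr) l) := by
  have h1 : (tanField y l (emb y x)) ∘ Sum.inl = Pi.single l 1 := rfl
  have h2 : (v ∘ Sum.inl) ⬝ᵥ (mixedHess c (emb y x)).mulVec (tanField y l (emb y x) ∘ Sum.inr)
      = -U.mulVec (v ∘ Sum.inl) l := by
    rw [hU, dotProduct_comm]
    simp only [Matrix.mulVec, Matrix.neg_apply, dotProduct, Matrix.mul_apply,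
      Matrix.transpose_apply, jac, Matrix.of_apply, neg_mul, Finset.sum_neg_distrib, neg_neg]
    refine Finset.sum_congr rfl fun i _ => ?_
    congr 1
    exact Finset.sum_congr rfl fun k _ => mul_comm _ _
  rw [pairing_kmMetric, h1, h2, single_dotProduct]
  ring

lemma indMetric_eq {U : Matrix (Fin d) (Fin d) ℝ}
    (hU : U = -(jac y x * (mixedHess c (emb y x)).transpose)) (hs : U.IsSymm) :
    indMetric c y x = U := by
  ext i j
  have h1 : (mixedHess c (emb y x)).mulVec (tanField y i (emb y x) ∘ Sum.inr) j = -U i j := by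
    rw [hU]
    simp only [Matrix.mulVec, Matrix.neg_apply, dotProduct, Matrix.mul_apply,
      Matrix.transpose_apply, jac, Matrix.of_apply, neg_neg]
    exact Finset.sum_congr rfl fun k _ => mul_comm _ _
  have h2 : (tanField y i (emb y x)) ∘ Sum.inl = Pi.single i 1 := rfl
  rw [indMetric, Matrix.of_apply, pairing_tanField hU, h1, h2, Matrix.mulVec_single_one]
  simp only [Matrix.col_apply]
  rw [hs.apply i j]
  ring

/-- On normal vectors, the metric is minus the pullback by `K` of the induced metric. -/
lemma pairing_normal {U : Matrix (Fin d) (Fin d) ℝ}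
    (hU : U = -(jac y x * (mixedHess c (emb y x)).transpose)) (hs : U.IsSymm) (hd : U.det ≠ 0)
    {v w : Fin d ⊕ Fin d → ℝ}
    (hv : ∀ l, pairing (kmMetric c (emb y x)) v (tanField y l (emb y x)) = 0)
    (hw : ∀ l, pairing (kmMetric c (emb y x)) w (tanField y l (emb y x)) = 0) :
    pairing (kmMetric c (emb y x)) v w
      = -∑ s, ∑ t, pairing (kmMetric c (emb y x)) (paraK v) (tanField y s (emb y x))
          * pairing (kmMetric c (emb y x)) (paraK w) (tanField y t (emb y x)) * U⁻¹ s t := by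
  have hn : ∀ v : Fin d ⊕ Fin d → ℝ,
      (∀ l, pairing (kmMetric c (emb y x)) v (tanField y l (emb y x)) = 0) →
      (mixedHess c (emb y x)).mulVec (v ∘ Sum.inr) = U.mulVec (v ∘ Sum.inl) := by
    intro v hv
    ext l
    have := hv l
    rw [pairing_tanField hU] at this
    linarith
  -- K flips the sign of the barred half, so the two equal halves add instead of cancelling.
  have hK : ∀ v : Fin d ⊕ Fin d → ℝ,
      (∀ l, pairing (kmMetric c (emb y x)) v (tanField y l (emb y x)) = 0) → ∀ l,
      pairing (kmMetric c (emb y x)) (paraK v) (tanField y l (emb y x))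
        = U.mulVec (v ∘ Sum.inl) l := by
    intro v hv l
    have h1 : paraK v ∘ Sum.inl = v ∘ Sum.inl := rfl
    have h2 : paraK v ∘ Sum.inr = -(v ∘ Sum.inr) := rfl
    rw [pairing_tanField hU, h1, h2, Matrix.mulVec_neg, hn v hv, Pi.neg_apply]
    ring
  have h3 : ∀ a b : Fin d → ℝ, a ⬝ᵥ U.mulVec b = b ⬝ᵥ U.mulVec a := fun a b => by
    rw [Matrix.dotProduct_mulVec, ← Matrix.mulVec_transpose, hs, dotProduct_comm]
  have h4 : ∀ a b : Fin d → ℝ, ∑ s, ∑ t, U.mulVec a s * U.mulVec b t * U⁻¹ s t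
      = U.mulVec a ⬝ᵥ b := by
    intro a b
    have : b = U⁻¹.mulVec (U.mulVec b) := by
      rw [Matrix.mulVec_mulVec, Matrix.nonsing_inv_mul _ (Ne.isUnit hd), Matrix.one_mulVec]
    conv_rhs => rw [this]
    refine Finset.sum_congr rfl fun s _ => ?_
    change _ = U.mulVec a s * ∑ t, U⁻¹ s t * U.mulVec b t
    rw [Finset.mul_sum]
    exact Finset.sum_congr rfl fun t _ => by ring
  simp only [hK v hv, hK w hw]
  -- Replacing Cη by Uξ in both halves of the metric leaves minus the U-pairing of the unbarred
  -- parts.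
  rw [h4, pairing_kmMetric, hn v hv, hn w hw, h3 (w ∘ Sum.inl), dotProduct_comm (U.mulVec _),
    h3 (w ∘ Sum.inl)]
  ring

end Graph

/-! ### Trace identities -/

section Traces

variable {d : ℕ}

lemma sum_contract {α β : Type} [Fintype α] [Fintype β] (X : α → α → ℝ) (M : β → β → ℝ)
    (P Q : α → β → ℝ) :
    ∑ a, ∑ b, X a b * ∑ a', ∑ b', M a' b' * P a a' * Q b b'
      = ∑ a', ∑ b', M a' b' * ∑ a, ∑ b, P a a' * X a b * Q b b' := by
  have h1 : ∑ a, ∑ b, X a b * ∑ a', ∑ b', M a' b' * P a a' * Q b b'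
      = ∑ u : α × α, ∑ v : β × β, X u.1 u.2 * (M v.1 v.2 * P u.1 v.1 * Q u.2 v.2) := by
    simp only [Fintype.sum_prod_type, Finset.mul_sum]
  have h2 : ∑ a', ∑ b', M a' b' * ∑ a, ∑ b, P a a' * X a b * Q b b'
      = ∑ v : β × β, ∑ u : α × α, M v.1 v.2 * (P u.1 v.1 * X u.1 u.2 * Q u.2 v.2) := by
    simp only [Fintype.sum_prod_type, Finset.mul_sum]
  rw [h1, h2, Finset.sum_comm]
  exact Finset.sum_congr rfl fun _ _ => Finset.sum_congr rfl fun _ _ => by ring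

/-- The trace `γ^{ik} γ^{jl} T_{ijkl}`. -/
noncomputable def doubleTrace (γ : Matrix (Fin d) (Fin d) ℝ)
    (T : Fin d → Fin d → Fin d → Fin d → ℝ) : ℝ :=
  ∑ i, ∑ j, ∑ k, ∑ l, γ i k * γ j l * T i j k l

lemma doubleTrace_add (γ : Matrix (Fin d) (Fin d) ℝ) (T T' : Fin d → Fin d → Fin d → Fin d → ℝ) :
    doubleTrace γ (fun i j k l => T i j k l + T' i j k l) = doubleTrace γ T + doubleTrace γ T' := by
  simp only [doubleTrace, mul_add, Finset.sum_add_distrib]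

lemma doubleTrace_sub (γ : Matrix (Fin d) (Fin d) ℝ) (T T' : Fin d → Fin d → Fin d → Fin d → ℝ) :
    doubleTrace γ (fun i j k l => T i j k l - T' i j k l) = doubleTrace γ T - doubleTrace γ T' := by
  simp only [doubleTrace, mul_sub, Finset.sum_sub_distrib]

lemma doubleTrace_swap (γ : Matrix (Fin d) (Fin d) ℝ) (T : Fin d → Fin d → Fin d → Fin d → ℝ) :
    doubleTrace γ (fun i j k l => T j i l k) = doubleTrace γ T := by
  unfold doubleTrace
  rw [Finset.sum_comm]
  refine Finset.sum_congr rfl fun i _ => Finset.sum_congr rfl fun j _ => ?_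
  rw [Finset.sum_comm]
  exact Finset.sum_congr rfl fun k _ => Finset.sum_congr rfl fun l _ => by ring

lemma doubleTrace_inner (γ : Matrix (Fin d) (Fin d) ℝ) (T : Fin d → Fin d → Fin d → Fin d → ℝ) :
    doubleTrace γ T = ∑ i, ∑ k, ∑ j, ∑ l, γ i k * γ j l * T i j k l :=
  Finset.sum_congr rfl fun _ _ => Finset.sum_comm

/-- Tracing the components `R_{i j̄ k l̄}`. -/
lemma doubleTrace_parallel (γ D : Matrix (Fin d) (Fin d) ℝ)
    (R : Fin d → Fin d → Fin d → Fin d → ℝ) :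
    doubleTrace γ (fun i j k l => ∑ j', ∑ l', R i j' k l' * D j j' * D l l')
      = ∑ i, ∑ j, ∑ k, ∑ l, R i j k l * γ i k * (D.transpose * γ * D) j l := by
  have h : ∀ i k, ∑ j, ∑ l, γ i k * γ j l * (∑ j', ∑ l', R i j' k l' * D j j' * D l l')
      = ∑ j, ∑ l, R i j k l * γ i k * (D.transpose * γ * D) j l := by
    intro i k
    rw [sum_contract (fun j l => γ i k * γ j l) (fun j' l' => R i j' k l') D D]
    refine Finset.sum_congr rfl fun j' _ => Finset.sum_congr rfl fun l' _ => ?_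
    simp only [Matrix.mul_apply, Matrix.transpose_apply, Finset.sum_mul, Finset.mul_sum]
    rw [Finset.sum_comm]
    exact Finset.sum_congr rfl fun j _ => Finset.sum_congr rfl fun l _ => by ring
  rw [doubleTrace_inner]
  refine Finset.sum_congr rfl fun i _ => ?_
  simp only [h]
  exact Finset.sum_comm

/-- Tracing the components `R_{i j̄ k̄ l}`. -/
lemma doubleTrace_crossed {γ : Matrix (Fin d) (Fin d) ℝ} (hγ : γ.IsSymm)
    (D : Matrix (Fin d) (Fin d) ℝ) (R : Fin d → Fin d → Fin d → Fin d → ℝ) :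
    doubleTrace γ (fun i j k l => ∑ j', ∑ k', R i j' k' l * D j j' * D k k')
      = ∑ i, ∑ j, ∑ k, ∑ l, (γ * D) i k * (γ * D) l j * R i j k l := by
  have h : ∀ i l, ∑ j, ∑ k, γ i k * γ j l * (∑ j', ∑ k', R i j' k' l * D j j' * D k k')
      = ∑ j, ∑ k, (γ * D) i k * (γ * D) l j * R i j k l := by
    intro i l
    rw [sum_contract (fun j k => γ i k * γ j l) (fun j' k' => R i j' k' l) D D]
    refine Finset.sum_congr rfl fun j' _ => Finset.sum_congr rfl fun k' _ => ?_
    simp only [Matrix.mul_apply]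
    rw [mul_comm, Finset.sum_mul_sum, Finset.sum_comm]
    congr 1
    refine Finset.sum_congr rfl fun k _ => Finset.sum_congr rfl fun j _ => ?_
    rw [hγ.apply l j]; ring
  unfold doubleTrace
  refine Finset.sum_congr rfl fun i _ => ?_
  have e1 : ∀ f : Fin d → Fin d → Fin d → ℝ, ∑ j, ∑ k, ∑ l, f j k l = ∑ l, ∑ j, ∑ k, f j k l := by
    intro f
    rw [Finset.sum_comm (s := Finset.univ (α := Fin d)) (f := fun l j => ∑ k, f j k l)]
    exact Finset.sum_congr rfl fun j _ => Finset.sum_comm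
  exact (e1 _).trans ((Finset.sum_congr rfl fun l _ => h i l).trans (e1 _).symm)

/-- The scalar curvature of a metric with null coordinate foliations. -/
lemma scalar_blocks (N : Matrix (Fin d) (Fin d) ℝ)
    (R : Fin d ⊕ Fin d → Fin d ⊕ Fin d → Fin d ⊕ Fin d → Fin d ⊕ Fin d → ℝ)
    (hswap : ∀ a b c e, R a b c e = R b a e c)
    (hleft : ∀ a b c e, a.isLeft = b.isLeft → R a b c e = 0) :
    ∑ a, ∑ b, ∑ c, ∑ e, (Matrix.fromBlocks 0 ((2 : ℝ) • N) ((2 : ℝ) • N.transpose) 0 :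
        Matrix (Fin d ⊕ Fin d) (Fin d ⊕ Fin d) ℝ) a c *
        (Matrix.fromBlocks 0 ((2 : ℝ) • N) ((2 : ℝ) • N.transpose) 0 :
        Matrix (Fin d ⊕ Fin d) (Fin d ⊕ Fin d) ℝ) b e * R a b c e
      = 8 * ∑ i, ∑ j, ∑ k, ∑ l, N i k * N l j
          * R (Sum.inl i) (Sum.inr j) (Sum.inr k) (Sum.inl l) := by
  have hll : ∀ i j c e, R (Sum.inl i) (Sum.inl j) c e = 0 := fun i j c e => hleft _ _ _ _ rfl
  have hrr : ∀ i j c e, R (Sum.inr i) (Sum.inr j) c e = 0 := fun i j c e => hleft _ _ _ _ rfl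
  simp only [Fintype.sum_sum_type, hll, hrr, Matrix.fromBlocks_apply₁₁,
    Matrix.fromBlocks_apply₁₂, Matrix.fromBlocks_apply₂₁, Matrix.fromBlocks_apply₂₂,
    Matrix.zero_apply, zero_mul, mul_zero, Finset.sum_const_zero, zero_add, add_zero,
    Matrix.smul_apply, Matrix.transpose_apply, smul_eq_mul]
  have h1 : ∑ i, ∑ j, ∑ k, ∑ l, 2 * N i k * (2 * N l j)
        * R (Sum.inl i) (Sum.inr j) (Sum.inr k) (Sum.inl l)
      = 4 * ∑ i, ∑ j, ∑ k, ∑ l, N i k * N l j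
          * R (Sum.inl i) (Sum.inr j) (Sum.inr k) (Sum.inl l) := by
    simp only [Finset.mul_sum]
    exact Finset.sum_congr rfl fun _ _ => Finset.sum_congr rfl fun _ _ =>
      Finset.sum_congr rfl fun _ _ => Finset.sum_congr rfl fun _ _ => by ring
  -- Two index patterns survive, exchanged by `hswap`; each carries 2 · 2 from the blocks, whence
  -- the factor 8.
  have h2 : ∑ i, ∑ j, ∑ k, ∑ l, 2 * N k i * (2 * N j l)
        * R (Sum.inr i) (Sum.inl j) (Sum.inl k) (Sum.inr l)
      = ∑ i, ∑ j, ∑ k, ∑ l, 2 * N i k * (2 * N l j)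
        * R (Sum.inl i) (Sum.inr j) (Sum.inr k) (Sum.inl l) := by
    rw [Finset.sum_comm]
    refine Finset.sum_congr rfl fun i _ => Finset.sum_congr rfl fun j _ => ?_
    rw [Finset.sum_comm]
    refine Finset.sum_congr rfl fun k _ => Finset.sum_congr rfl fun l _ => ?_
    rw [hswap (Sum.inr j)]; ring
  rw [h2, h1]
  ring

end Traces

/-! ### Assembly of the two identities -/

section Main

variable {d : ℕ} {c : (Fin d → ℝ) → (Fin d → ℝ) → ℝ} {φ ψ : (Fin d → ℝ) → ℝ}
  {y : (Fin d → ℝ) → Fin d → ℝ} {x : Fin d → ℝ}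

lemma isMetricAt_indMetric (hc : ContDiffAt ℝ 4 (costFun c) (emb y x)) (hy : ContDiffAt ℝ 3 y x)
    (hdet : (indMetric c y x).det ≠ 0) (hC : IsUnit (mixedHess c (emb y x)).det) :
    IsMetricAt (indMetric c y) x where
  smooth i j := by
    have hF : ContDiffAt ℝ 2 (emb y) x :=
      (contDiffAt_pi.2 (contDiffAt_emb hy)).of_le (by norm_num)
    have hG : ∀ a b, ContDiffAt ℝ 2 (fun s => kmMetric c (emb y s) a b) x := fun a b =>
      ((isMetricAt_kmMetric hc hC).smooth a b).comp x hF
    have hv : ∀ i a, ContDiffAt ℝ 2 (fun s => velocity (emb y) i s a) x := fun i a =>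
      contDiffAt_velocity (contDiffAt_emb hy) (by norm_num) i a
    rw [← pullback_emb]
    simp only [pullback, Matrix.of_apply, pairing]
    exact ContDiffAt.sum fun a _ => ContDiffAt.sum fun b _ =>
      ((hG a b).mul (hv i a)).mul (hv j b)
  symm := Eventually.of_forall fun q => by
    rw [← pullback_emb]; exact pullback_isSymm (kmMetric_isSymm c _)
  det := hdet

/-- Of the sixteen choices of index types, only those with both pairs mixed contribute. -/
lemma sum_tanField (R : Fin d ⊕ Fin d → Fin d ⊕ Fin d → Fin d ⊕ Fin d → Fin d ⊕ Fin d → ℝ)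
    (hleft : ∀ a b c e, a.isLeft = b.isLeft → R a b c e = 0)
    (hright : ∀ a b c e, c.isLeft = e.isLeft → R a b c e = 0) (i j k l : Fin d) :
    ∑ a, ∑ b, ∑ c, ∑ e, R a b c e * tanField y i (emb y x) a * tanField y j (emb y x) b
        * tanField y k (emb y x) c * tanField y l (emb y x) e
      = (∑ j', ∑ k', R (Sum.inl i) (Sum.inr j') (Sum.inr k') (Sum.inl l)
          * dy y j j' x * dy y k k' x)
        + (∑ j', ∑ l', R (Sum.inl i) (Sum.inr j') (Sum.inl k) (Sum.inr l')
          * dy y j j' x * dy y l l' x)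
        + (∑ i', ∑ k', R (Sum.inr i') (Sum.inl j) (Sum.inr k') (Sum.inl l)
          * dy y i i' x * dy y k k' x)
        + (∑ i', ∑ l', R (Sum.inr i') (Sum.inl j) (Sum.inl k) (Sum.inr l')
          * dy y i i' x * dy y l l' x) := by
  have hll : ∀ i j c e, R (Sum.inl i) (Sum.inl j) c e = 0 := fun i j c e => hleft _ _ _ _ rfl
  have hrr : ∀ i j c e, R (Sum.inr i) (Sum.inr j) c e = 0 := fun i j c e => hleft _ _ _ _ rfl
  have hll' : ∀ a b i j, R a b (Sum.inl i) (Sum.inl j) = 0 := fun a b i j => hright _ _ _ _ rfl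
  have hrr' : ∀ a b i j, R a b (Sum.inr i) (Sum.inr j) = 0 := fun a b i j => hright _ _ _ _ rfl
  have hl : ∀ i a, tanField y i (emb y x) (Sum.inl a) = (Pi.single i 1 : Fin d → ℝ) a :=
    fun _ _ => rfl
  have hr : ∀ i a, tanField y i (emb y x) (Sum.inr a) = dy y i a x := fun _ _ => rfl
  simp [Fintype.sum_sum_type, hll, hrr, hll', hrr', hl, hr, Pi.single_apply,
    Finset.sum_add_distrib]
  ring

/-- The Gauss equation for the graph of `y`. -/
lemma gauss_graph (hc : ContDiffAt ℝ 4 (costFun c) (emb y x)) (hy : ContDiffAt ℝ 3 y x)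
    (hdet : (indMetric c y x).det ≠ 0) (hC : IsUnit (mixedHess c (emb y x)).det)
    (i j k l : Fin d) :
    (∑ j', ∑ k', riem (kmMetric c) (Sum.inl i) (Sum.inr j') (Sum.inr k') (Sum.inl l) (emb y x)
          * dy y j j' x * dy y k k' x)
      + (∑ j', ∑ l', riem (kmMetric c) (Sum.inl i) (Sum.inr j') (Sum.inl k) (Sum.inr l') (emb y x)
          * dy y j j' x * dy y l l' x)
      + (∑ i', ∑ k', riem (kmMetric c) (Sum.inr i') (Sum.inl j) (Sum.inr k') (Sum.inl l) (emb y x)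
          * dy y i i' x * dy y k k' x)
      + (∑ i', ∑ l', riem (kmMetric c) (Sum.inr i') (Sum.inl j) (Sum.inl k) (Sum.inr l') (emb y x)
          * dy y i i' x * dy y l l' x)
      = riem (indMetric c y) i j k l x
        - pairing (kmMetric c (emb y x)) (secondFF c y (tanField y i) (tanField y k) x)
            (secondFF c y (tanField y j) (tanField y l) x)
        + pairing (kmMetric c (emb y x)) (secondFF c y (tanField y i) (tanField y l) x)
            (secondFF c y (tanField y j) (tanField y k) x) := by
  have hK := isParaKahlerAt_kmMetric hc hC
  have hy2 : ContDiffAt ℝ 2 y x := hy.of_le (by norm_num)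
  have hg : IsMetricAt (pullback (kmMetric c) (emb y)) x := by
    rw [pullback_emb]; exact isMetricAt_indMetric hc hy hdet hC
  have h := gauss_equation hK.metric (contDiffAt_emb hy) hg i j k l
  simp only [← secondFF_eq c hy2, pullback_emb, velocity_emb] at h
  rw [← h]
  exact (sum_tanField (fun a b c' e => riem (kmMetric c) a b c' e (emb y x))
    (fun a b c' e hab => hK.riem_eq_zero_left c' e hab)
    (fun a b c' e hce => hK.riem_eq_zero_right a b hce) i j k l).symm

lemma secondFF_symm (hc : ContDiffAt ℝ 4 (costFun c) (emb y x)) (hy : ContDiffAt ℝ 3 y x)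
    (hC : IsUnit (mixedHess c (emb y x)).det) (i j : Fin d) :
    secondFF c y (tanField y i) (tanField y j) x = secondFF c y (tanField y j) (tanField y i) x := by
  have hy2 : ContDiffAt ℝ 2 y x := hy.of_le (by norm_num)
  rw [secondFF_eq c hy2, secondFF_eq c hy2,
    alongDeriv_velocity_comm (isMetricAt_kmMetric hc hC) (contDiffAt_emb hy2)]

lemma pairing_secondFF (hy : ContDiffAt ℝ 3 y x)
    {U : Matrix (Fin d) (Fin d) ℝ}
    (hU : U = -(jac y x * (mixedHess c (emb y x)).transpose)) (hs : U.IsSymm) (hd : U.det ≠ 0)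
    (i j k l : Fin d) :
    pairing (kmMetric c (emb y x)) (secondFF c y (tanField y i) (tanField y j) x)
        (secondFF c y (tanField y k) (tanField y l) x)
      = -∑ s, ∑ t, hCov c y i j s x * hCov c y k l t x * U⁻¹ s t := by
  have hy2 : ContDiffAt ℝ 2 y x := hy.of_le (by norm_num)
  have hg : (pullback (kmMetric c) (emb y) x).det ≠ 0 := by
    rw [pullback_emb, indMetric_eq hU hs]; exact hd
  have hn : ∀ i j l, pairing (kmMetric c (emb y x)) (secondFF c y (tanField y i) (tanField y j) x)
      (tanField y l (emb y x)) = 0 := by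
    intro i j l
    rw [secondFF_eq c hy2, ← velocity_emb]
    exact pairing_normalPart_velocity (kmMetric_isSymm c _) hg _ l
  exact pairing_normal hU hs hd (hn i j) (hn k l)

lemma normSqH_eq (c : (Fin d → ℝ) → (Fin d → ℝ) → ℝ) (y : (Fin d → ℝ) → Fin d → ℝ)
    (x : Fin d → ℝ) :
    normSqH c y x = doubleTrace (indMetric c y x)⁻¹ fun i j k l =>
      pairing (kmMetric c (emb y x)) (secondFF c y (tanField y i) (tanField y k) x)
        (secondFF c y (tanField y j) (tanField y l) x) := by
  rw [doubleTrace_inner, normSqH, meanCurv]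
  simp only [pairing_sum_left, pairing_sum_right, pairing_smul_left, pairing_smul_right,
    Finset.mul_sum, mul_assoc]
  refine Finset.sum_congr rfl fun i _ => Finset.sum_congr rfl fun k _ =>
    Finset.sum_congr rfl fun j _ => Finset.sum_congr rfl fun l _ => ?_
  rw [pairing_comm (kmMetric_isSymm c _)]

/-- Renaming j and l and using the symmetry of h and of g⁻¹ gives the index order in which this
product occurs in the Gauss equation. -/
lemma normSqh_eq (hsymm : ∀ i j, secondFF c y (tanField y i) (tanField y j) x
      = secondFF c y (tanField y j) (tanField y i) x) (hs : ((indMetric c y x)⁻¹).IsSymm) :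
    normSqh c y x = doubleTrace (indMetric c y x)⁻¹ fun i j k l =>
      pairing (kmMetric c (emb y x)) (secondFF c y (tanField y i) (tanField y l) x)
        (secondFF c y (tanField y j) (tanField y k) x) := by
  unfold normSqh doubleTrace
  refine Finset.sum_congr rfl fun i _ => ?_
  rw [sum_comm_outer]
  refine Finset.sum_congr rfl fun l _ => Finset.sum_congr rfl fun k _ =>
    Finset.sum_congr rfl fun j _ => ?_
  rw [hsymm k l, hs.apply l j]

/-- The traced Gauss equation for the graph of `y`. -/
lemma traced_gauss (hc : ContDiffAt ℝ 4 (costFun c) (emb y x)) (hy : ContDiffAt ℝ 3 y x)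
    {U W : Matrix (Fin d) (Fin d) ℝ}
    (hU : U = -(jac y x * (mixedHess c (emb y x)).transpose)) (hs : U.IsSymm) (hd : U.det ≠ 0)
    (hC : IsUnit (mixedHess c (emb y x)).det)
    (hW : mixedHess c (emb y x) = -(jac y x * W)) :
    ∑ i, ∑ j, ∑ k, ∑ l, riem (kmMetric c) (Sum.inl i) (Sum.inr j) (Sum.inl k) (Sum.inr l) (emb y x)
        * U⁻¹ i k * W⁻¹ j l
      = -(1 / 8) * scalarCurv (kmMetric c) (emb y x) + 1 / 2 * scalarCurv (indMetric c y) x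
        - 1 / 2 * normSqH c y x + 1 / 2 * normSqh c y x := by
  have hind : indMetric c y x = U := indMetric_eq hU hs
  have hdet : (indMetric c y x).det ≠ 0 := by rw [hind]; exact hd
  have hK := isParaKahlerAt_kmMetric hc hC
  have hUi : (U⁻¹).IsSymm := hs.inv
  set D := jac y x with hD
  set C := mixedHess c (emb y x) with hCdef
  set R := fun a b c' e => riem (kmMetric c) a b c' e (emb y x) with hR
  have hswap : ∀ a b c e, R a b c e = R b a e c := fun a b c' e => by
    simp only [hR]
    rw [riem_swap_left hK.metric, riem_swap_right hK.metric, neg_neg]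
  have hleft : ∀ a b c e, a.isLeft = b.isLeft → R a b c e = 0 := fun a b c' e hab =>
    hK.riem_eq_zero_left c' e hab
  have hUC : U = -(C * D.transpose) := by
    rw [← hs, hU, Matrix.transpose_neg, Matrix.transpose_mul, Matrix.transpose_transpose]
  have hCi : C⁻¹ = -(D.transpose * U⁻¹) := by
    refine Matrix.inv_eq_right_inv ?_
    rw [mul_neg, ← mul_assoc, ← neg_mul, ← hUC, Matrix.mul_nonsing_inv _ (Ne.isUnit hd)]
  -- Since D W = -C and C⁻¹ = -DᵀU⁻¹, multiplying the right-hand side by W gives C⁻¹ C = 1.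
  have hWi : W⁻¹ = D.transpose * U⁻¹ * D := by
    refine Matrix.inv_eq_left_inv ?_
    have : D * W = -C := by rw [hW, neg_neg]
    rw [mul_assoc, this, mul_neg, ← neg_mul, ← hCi, Matrix.nonsing_inv_mul _ hC]
  have hGi : (kmMetric c (emb y x))⁻¹
      = Matrix.fromBlocks 0 ((2 : ℝ) • (U⁻¹ * D)) ((2 : ℝ) • (U⁻¹ * D).transpose) 0 := by
    rw [kmMetric_inv hC, ← hCdef, hCi, Matrix.transpose_mul, hUi]
    simp [Matrix.transpose_mul, hUi.eq]
  have hscal : scalarCurv (kmMetric c) (emb y x)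
      = 8 * doubleTrace U⁻¹ fun i j k l => ∑ j', ∑ k',
          R (Sum.inl i) (Sum.inr j') (Sum.inr k') (Sum.inl l) * D j j' * D k k' := by
    rw [doubleTrace_crossed hUi D fun i j k l => R (Sum.inl i) (Sum.inr j) (Sum.inr k) (Sum.inl l),
      scalarCurv, hGi]
    exact scalar_blocks (U⁻¹ * D) R hswap hleft
  have hlhs := doubleTrace_parallel U⁻¹ D
    fun i j k l => R (Sum.inl i) (Sum.inr j) (Sum.inl k) (Sum.inr l)
  -- The four terms form two pairs, exchanged by (i, k) ↔ (j, l); the curvature symmetry `hswap`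
  -- gives both members of a pair the same trace.
  have h3 : doubleTrace U⁻¹ (fun i j k l => ∑ i', ∑ k',
        R (Sum.inr i') (Sum.inl j) (Sum.inr k') (Sum.inl l) * D i i' * D k k')
      = doubleTrace U⁻¹ fun i j k l => ∑ j', ∑ l',
        R (Sum.inl i) (Sum.inr j') (Sum.inl k) (Sum.inr l') * D j j' * D l l' := by
    rw [← doubleTrace_swap]
    simp only [hswap (Sum.inr _) (Sum.inl _)]
  have h4 : doubleTrace U⁻¹ (fun i j k l => ∑ i', ∑ l',
        R (Sum.inr i') (Sum.inl j) (Sum.inl k) (Sum.inr l') * D i i' * D l l')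
      = doubleTrace U⁻¹ fun i j k l => ∑ j', ∑ k',
        R (Sum.inl i) (Sum.inr j') (Sum.inr k') (Sum.inl l) * D j j' * D k k' := by
    rw [← doubleTrace_swap]
    simp only [hswap (Sum.inr _) (Sum.inl _)]
  have hg : (fun i j k l => (∑ j', ∑ k',
          R (Sum.inl i) (Sum.inr j') (Sum.inr k') (Sum.inl l) * D j j' * D k k')
        + (∑ j', ∑ l', R (Sum.inl i) (Sum.inr j') (Sum.inl k) (Sum.inr l') * D j j' * D l l')
        + (∑ i', ∑ k', R (Sum.inr i') (Sum.inl j) (Sum.inr k') (Sum.inl l) * D i i' * D k k')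
        + (∑ i', ∑ l', R (Sum.inr i') (Sum.inl j) (Sum.inl k) (Sum.inr l') * D i i' * D l l'))
      = fun i j k l => riem (indMetric c y) i j k l x
        - pairing (kmMetric c (emb y x)) (secondFF c y (tanField y i) (tanField y k) x)
            (secondFF c y (tanField y j) (tanField y l) x)
        + pairing (kmMetric c (emb y x)) (secondFF c y (tanField y i) (tanField y l) x)
            (secondFF c y (tanField y j) (tanField y k) x) := by
    funext i j k l
    exact gauss_graph hc hy hdet hC i j k l
  have ht := congrArg (doubleTrace U⁻¹) hg
  simp only [doubleTrace_add, doubleTrace_sub] at ht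
  rw [h3, h4] at ht
  have hH := normSqH_eq c y x
  have hh := normSqh_eq (c := c) (y := y) (x := x) (secondFF_symm hc hy hC) (by rw [hind]; exact hUi)
  rw [hind] at hH hh
  have hsc : scalarCurv (indMetric c y) x
      = doubleTrace U⁻¹ fun i j k l => riem (indMetric c y) i j k l x := by
    rw [scalarCurv, hind]; rfl
  rw [hWi]
  change ∑ i, ∑ j, ∑ k, ∑ l, R (Sum.inl i) (Sum.inr j) (Sum.inl k) (Sum.inr l)
    * U⁻¹ i k * (D.transpose * U⁻¹ * D) j l = _
  rw [← hlhs, hscal, hsc, hH, hh]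
  linarith

end Main

end KimMcCann

theorem lemma2p6 (d : ℕ) (X Y : Set (Fin d → ℝ)) (hX : IsOpen X) (hY : IsOpen Y)
    (c : (Fin d → ℝ) → (Fin d → ℝ) → ℝ) (φ ψ : (Fin d → ℝ) → ℝ) (y : (Fin d → ℝ) → Fin d → ℝ)
    (hyY : Set.MapsTo y X Y) (hy : ContDiffOn ℝ 3 y X)
    (hc : ∀ x ∈ X, ContDiffAt ℝ 4 (fun p : (Fin d → ℝ) × (Fin d → ℝ) => c p.1 p.2) (x, y x))
    (hφ : ∀ x ∈ X, ContDiffAt ℝ 2 φ x) (hψ : ∀ x ∈ X, ContDiffAt ℝ 2 ψ (y x))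
    (hu : ∀ x ∈ X, ∀ z ∈ Y, 0 ≤ KimMcCann.cDiv c φ ψ x z)
    (hSigma : ∀ x ∈ X, ∀ z ∈ Y, KimMcCann.cDiv c φ ψ x z = 0 ↔ z = y x)
    (hdef : ∀ x ∈ X, ∀ v : Fin d → ℝ, v ≠ 0 →
      KimMcCann.pairing (KimMcCann.indMetric c y x) v v ≠ 0) :
    (∀ x ∈ X, ∀ i j k l : Fin d,
      (∑ j', ∑ k', KimMcCann.riem (KimMcCann.kmMetric c) (Sum.inl i) (Sum.inr j') (Sum.inr k')
          (Sum.inl l) (KimMcCann.emb y x) * KimMcCann.dy y j j' x * KimMcCann.dy y k k' x)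
      + (∑ j', ∑ l', KimMcCann.riem (KimMcCann.kmMetric c) (Sum.inl i) (Sum.inr j') (Sum.inl k)
          (Sum.inr l') (KimMcCann.emb y x) * KimMcCann.dy y j j' x * KimMcCann.dy y l l' x)
      + (∑ i', ∑ k', KimMcCann.riem (KimMcCann.kmMetric c) (Sum.inr i') (Sum.inl j) (Sum.inr k')
          (Sum.inl l) (KimMcCann.emb y x) * KimMcCann.dy y i i' x * KimMcCann.dy y k k' x)
      + (∑ i', ∑ l', KimMcCann.riem (KimMcCann.kmMetric c) (Sum.inr i') (Sum.inl j) (Sum.inl k)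
          (Sum.inr l') (KimMcCann.emb y x) * KimMcCann.dy y i i' x * KimMcCann.dy y l l' x)
      = KimMcCann.riem (KimMcCann.indMetric c y) i j k l x
        + (∑ s, ∑ t, KimMcCann.hCov c y i k s x * KimMcCann.hCov c y j l t x
            * (KimMcCann.uHessX c φ ψ y x)⁻¹ s t)
        - (∑ s, ∑ t, KimMcCann.hCov c y i l s x * KimMcCann.hCov c y j k t x
            * (KimMcCann.uHessX c φ ψ y x)⁻¹ s t))
    ∧ (∀ x ∈ X,
      (∑ i, ∑ j, ∑ k, ∑ l, KimMcCann.riem (KimMcCann.kmMetric c) (Sum.inl i) (Sum.inr j)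
          (Sum.inl k) (Sum.inr l) (KimMcCann.emb y x)
          * (KimMcCann.uHessX c φ ψ y x)⁻¹ i k * (KimMcCann.uHessY c φ ψ y x)⁻¹ j l)
      = -(1 / 8) * KimMcCann.scalarCurv (KimMcCann.kmMetric c) (KimMcCann.emb y x)
        + 1 / 2 * KimMcCann.scalarCurv (KimMcCann.indMetric c y) x
        - 1 / 2 * KimMcCann.normSqH c y x
        + 1 / 2 * KimMcCann.normSqh c y x) := by
  have hyx : ∀ x ∈ X, ContDiffAt ℝ 3 y x := fun x hx => hy.contDiffAt (hX.mem_nhds hx)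
  have hcx : ∀ x ∈ X, ContDiffAt ℝ 4 (KimMcCann.costFun c) (KimMcCann.emb y x) := fun x hx =>
    KimMcCann.contDiffAt_costFun (hc x hx)
  have h0 : ∀ x ∈ X, KimMcCann.cDiv c φ ψ x (y x) = 0 := fun x hx =>
    (hSigma x hx (y x) (hyY hx)).2 rfl
  have hU : ∀ x ∈ X, KimMcCann.uHessX c φ ψ y x
      = -(KimMcCann.jac y x * (KimMcCann.mixedHess c (KimMcCann.emb y x)).transpose) := by
    intro x hx
    refine KimMcCann.uHessX_eq (hcx x hx) (hφ x hx)
      ((hyx x hx).differentiableAt (by norm_num)) ?_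
    filter_upwards [hX.mem_nhds hx] with q hq
    exact KimMcCann.first_order_left hX hq hyY hu (h0 q hq) ((hcx q hq).of_le (by norm_num))
      ((hφ q hq).of_le (by norm_num))
  have hW : ∀ x ∈ X, KimMcCann.mixedHess c (KimMcCann.emb y x)
      = -(KimMcCann.jac y x * KimMcCann.uHessY c φ ψ y x) := by
    intro x hx
    refine KimMcCann.mixedHess_eq (hcx x hx) (hψ x hx)
      ((hyx x hx).differentiableAt (by norm_num)) ?_
    filter_upwards [hX.mem_nhds hx] with q hq
    exact KimMcCann.first_order_right hY hq hyY hu (h0 q hq) ((hcx q hq).of_le (by norm_num))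
      ((hψ q hq).of_le (by norm_num))
  have hs : ∀ x ∈ X, (KimMcCann.uHessX c φ ψ y x).IsSymm := fun x hx =>
    KimMcCann.uHessX_isSymm (hcx x hx) (hφ x hx)
  have hind : ∀ x ∈ X, KimMcCann.indMetric c y x = KimMcCann.uHessX c φ ψ y x := fun x hx =>
    KimMcCann.indMetric_eq (hU x hx) (hs x hx)
  have hd : ∀ x ∈ X, (KimMcCann.uHessX c φ ψ y x).det ≠ 0 := by
    intro x hx h
    -- A kernel vector of U would be a nonzero isotropic vector of g = U.
    obtain ⟨v, hv, hv0⟩ := Matrix.exists_mulVec_eq_zero_iff.2 h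
    refine hdef x hx v hv ?_
    rw [KimMcCann.pairing_eq, hind x hx, hv0, dotProduct_zero]
  have hC : ∀ x ∈ X, IsUnit (KimMcCann.mixedHess c (KimMcCann.emb y x)).det := by
    intro x hx
    refine Ne.isUnit fun h => hd x hx ?_
    rw [hU x hx, Matrix.det_neg, Matrix.det_mul, Matrix.det_transpose, h, mul_zero, mul_zero]
  refine ⟨fun x hx i j k l => ?_, fun x hx =>
    KimMcCann.traced_gauss (hcx x hx) (hyx x hx) (hU x hx) (hs x hx) (hd x hx) (hC x hx)
      (hW x hx)⟩
  -- Each product of normal vectors contributes the minus sign of `pairing_secondFF`, which reverses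
  -- the signs of the usual Gauss equation.
  rw [KimMcCann.gauss_graph (hcx x hx) (hyx x hx) (by rw [hind x hx]; exact hd x hx) (hC x hx),
    KimMcCann.pairing_secondFF (hyx x hx) (hU x hx) (hs x hx) (hd x hx),
    KimMcCann.pairing_secondFF (hyx x hx) (hU x hx) (hs x hx) (hd x hx)]
  ring
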